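/- Let $\beta>\pi/2$ and $$D'_\beta=\Big\{z\in\mathbb C^2:\ z_2\ne 0,\ \big|\operatorname{Im} z_1-\log|z_2|^2\big|<\tfrac{\pi}{2},\ \big|\log|z_2|^2\big|<\beta-\tfrac{\pi}{2}\Big\}.$$ Let $dV$ be Lebesgue volume measure. For $j\in\mathbb Z$ let $\mathcal H^j$ be the space of functions $f$ that are holomorphic and square integrable with respect to $dV$ on $D'_\beta$ and satisfy $f(z_1,e^{i\theta}z_2)=e^{ij\theta}f(z_1,z_2)$ for all $z\in D'_\beta$, $\theta\in\mathbb R$. Then $\mathcal H^j$ has exactly one Bergman kernel $K_j$ on $D'_\beta\times D'_\beta$ (that is, $K_j(\cdot,w)\in\mathcal H^j$ and $f(w)=\int_{D'_\beta}f(z)\overline{K_j(z,w)}\,dV(z)$ for all $w\in D'_\beta$, $f\in\mathcal H^j$), and $$K_j(z,w)=H_j(z_1,w_1)\,z_2^j\,\bar w_2^{\,j}\qquad (z,w\in D'_\beta),$$ where $$H_j(z_1,w_1)=\frac{1}{2\pi^2}\int_{-\infty}^{\infty}\frac{e^{i(z_1-\bar w_1)\xi}\,\xi\left(\xi-\frac{j+1}{2}\right)}{\sinh(\pi\xi)\,\sinh\!\left[(2\beta-\pi)\left(\xi-\frac{j+1}{2}\right)\right]}\,d\xi,$$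 the integral being absolutely convergent whenever $|\operatorname{Im} z_1|<\beta$ and $|\operatorname{Im} w_1|<\beta$. -/

import Mathlib

open MeasureTheory

noncomputable section

/-- The unbounded worm domain `D'_β` in `ℂ²`. The condition `|log |z₂|²| < β - π/2` excludes
`z₂ = 0` (where the logarithm is infinite); since `Real.log 0 = 0`, this is written out. -/
def wormDomain (β : ℝ) : Set (ℂ × ℂ) :=
  {z | z.2 ≠ 0 ∧ |z.1.im - Real.log (‖z.2‖ ^ 2)| < Real.pi / 2 ∧
    |Real.log (‖z.2‖ ^ 2)| < β - Real.pi / 2}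

/-- The Bergman space `A²(Ω)`: functions holomorphic on `Ω` and square integrable on `Ω` with
respect to Lebesgue volume measure. Values outside `Ω` are irrelevant. -/
def bergmanSpace (Ω : Set (ℂ × ℂ)) : Set (ℂ × ℂ → ℂ) :=
  {f | DifferentiableOn ℂ f Ω ∧ MemLp f 2 (volume.restrict Ω)}

/-- The `j`-th rotational Fourier component of the Bergman space: those `f` with
`f (z₁, e^{iθ} z₂) = e^{ijθ} f (z₁, z₂)` for all `z ∈ Ω` and all real `θ`. -/
def rotationalComponent (Ω : Set (ℂ × ℂ)) (j : ℤ) : Set (ℂ × ℂ → ℂ) :=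
  {f | f ∈ bergmanSpace Ω ∧ ∀ z ∈ Ω, ∀ θ : ℝ,
    f (z.1, Complex.exp (Complex.I * θ) * z.2) = Complex.exp (Complex.I * j * θ) * f z}

/-- `K` is the Bergman (reproducing) kernel on `Ω × Ω` of the space `A` of functions on `Ω`, for
the inner product `⟨f, g⟩ = ∫_Ω f ḡ dV`: each `K (·, w)` lies in `A`, and
`f w = ⟨f, K (·, w)⟩` for all `f ∈ A` and `w ∈ Ω`. -/
structure IsBergmanKernel (Ω : Set (ℂ × ℂ)) (A : Set (ℂ × ℂ → ℂ))
    (K : ℂ × ℂ → ℂ × ℂ → ℂ) : Prop where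
  mem : ∀ w ∈ Ω, (fun z => K z w) ∈ A
  reproducing : ∀ f ∈ A, ∀ w ∈ Ω, f w = ∫ z in Ω, f z * starRingEnd ℂ (K z w)

/-- The integrand of the Fourier integral. Its singularities at `ξ = 0` and `ξ = (j + 1) / 2` are
removable; the value taken there does not affect the integral. -/
def kernelIntegrand (β : ℝ) (j : ℤ) (z₁ w₁ : ℂ) (ξ : ℝ) : ℂ :=
  Complex.exp (Complex.I * (z₁ - starRingEnd ℂ w₁) * ξ) *
      ((ξ * (ξ - ((j : ℝ) + 1) / 2) : ℝ) : ℂ) /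
    ((Real.sinh (Real.pi * ξ) *
      Real.sinh ((2 * β - Real.pi) * (ξ - ((j : ℝ) + 1) / 2)) : ℝ) : ℂ)

/-- The factor `H_j (z₁, w₁)`. -/
def kernelFactor (β : ℝ) (j : ℤ) (z₁ w₁ : ℂ) : ℂ :=
  1 / (2 * (Real.pi : ℂ) ^ 2) * ∫ ξ : ℝ, kernelIntegrand β j z₁ w₁ ξ

end

/-! ### Plancherel and Fourier inversion without the `2π` in the exponent. -/

section

open scoped ContDiff ENNReal FourierTransform Topology Interval
open Filter

/-! Each `f` in the `j`-th component is `F(z₁) z₂ʲ` with `F` holomorphic on the strip `|Im z₁| < β`: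
in the coordinate `ζ = log z₂` the function `f z₂⁻ʲ` does not change in the imaginary direction,
hence is constant on each connected fibre (`eq_of_rotational`). A Fourier transform in `Re z₁` then
diagonalises the norm: the line at height `y` contributes `e^{-2yξ}`, and the weight at frequency
`ξ` is the integral of `e^{-2yξ}|z₂ʲ|²` over the pairs `(y, z₂)`. By `integral_weight` this weight
is `π` divided by the multiplier in `H_j`, so the kernel has Fourier density `(2π)⁻¹ / weight`,
which is the formula.

The multiplier decays at every exponential rate below `2β` (`multiplier_le`). This gives convergence
and holomorphy of `H_j` and, through Plancherel on lines, its square integrability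
(`wormKernel_mem`).

For the reproducing property, `F` need not be integrable on lines. It is bounded on thin horizontal
slabs (`wormFactor_locally_bounded`), so `F(z) e^{-εz²}` has Gaussian decay. For such functions
contour shifts, Fubini and Fourier inversion give the formula
(`integral_wormMeasure_mul_conj_kernelFactor`), and `ε → 0` follows by dominated convergence.
Uniqueness comes from letting two kernels reproduce each other. -/

/-- On `L¹ ∩ L²` the `L²` Fourier transform is given by the Fourier integral. -/
theorem Lp_fourier_toLp_ae_eq {g : ℝ → ℂ} (h1 : Integrable g) (h2 : MemLp g 2) :
    (𝓕 (h2.toLp g) : Lp ℂ 2 (volume : Measure ℝ)) =ᵐ[volume] 𝓕 g := by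
  have hcont : Continuous (𝓕 g) :=
    VectorFourier.fourierIntegral_continuous Real.continuous_fourierChar
      (by exact continuous_inner) h1
  -- It suffices to test against smooth compactly supported functions: on both sides the transform
  -- moves onto the test function.
  refine ae_eq_of_integral_contDiff_smul_eq
    ((Lp.memLp _).locallyIntegrable one_le_two) hcont.locallyIntegrable fun φ hφ hφc => ?_
  have hφ' : ContDiff ℝ ∞ (fun x => (φ x : ℂ)) := Complex.ofRealCLM.contDiff.comp hφ
  have hφc' : HasCompactSupport (fun x => (φ x : ℂ)) :=
    hφc.comp_left (g := ((↑) : ℝ → ℂ)) Complex.ofReal_zero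
  let Φ : SchwartzMap ℝ ℂ := hφc'.toSchwartzMap hφ'
  have e1 := congrArg (fun T => T Φ) (Lp.fourier_toTemperedDistribution_eq (h2.toLp g))
  simp only [TemperedDistribution.fourier_apply, Lp.toTemperedDistribution_apply] at e1
  have e2 : ∫ x, (𝓕 Φ) x • (h2.toLp g) x = ∫ x, (𝓕 Φ) x • g x := by
    apply integral_congr_ae
    filter_upwards [h2.coeFn_toLp] with x hx
    rw [hx]
  have e3 : ∫ x, (𝓕 Φ) x • g x = ∫ x, Φ x • 𝓕 g x := by
    have := VectorFourier.integral_fourierIntegral_smul_eq_flip (f := (Φ : ℝ → ℂ)) (g := g)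
      (L := innerₗ ℝ) (μ := volume) (ν := volume)
      Real.continuous_fourierChar continuous_inner Φ.integrable h1
    rw [flip_innerₗ] at this
    exact this
  have e4 : ∀ x, Φ x = (φ x : ℂ) := fun x => rfl
  rw [e2, e3] at e1
  simpa [e4] using e1.symm

theorem lintegral_enorm_fourier_sq {g : ℝ → ℂ} (h1 : Integrable g) (h2 : MemLp g 2) :
    ∫⁻ x, ‖𝓕 g x‖ₑ ^ 2 = ∫⁻ x, ‖g x‖ₑ ^ 2 := by
  have key : eLpNorm (𝓕 g) 2 = eLpNorm g 2 := by
    rw [← eLpNorm_congr_ae (Lp_fourier_toLp_ae_eq h1 h2), ← Lp.enorm_def,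
      ← eLpNorm_congr_ae h2.coeFn_toLp, ← Lp.enorm_def, enorm_eq_iff_norm_eq]
    exact Lp.norm_fourier_eq _
  simp only [eLpNorm_eq_lintegral_rpow_enorm_toReal two_ne_zero ENNReal.ofNat_ne_top,
    ENNReal.toReal_ofNat, ENNReal.rpow_ofNat] at key
  exact ENNReal.rpow_left_injective (by norm_num) key

/-- **Plancherel's theorem** for `x ↦ ∫ e^{ixξ} g(ξ) dξ` with `g ∈ L¹ ∩ L²`. -/
theorem lintegral_enorm_integral_cexp_mul_sq {g : ℝ → ℂ} (h1 : Integrable g) (h2 : MemLp g 2) :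
    ∫⁻ x : ℝ, ‖∫ ξ : ℝ, Complex.exp (Complex.I * x * ξ) * g ξ‖ₑ ^ 2 =
      ENNReal.ofReal (2 * Real.pi) * ∫⁻ ξ, ‖g ξ‖ₑ ^ 2 := by
  have hpi := Real.pi_pos
  -- Mathlib's `𝓕` has phase `e^{-2πi xξ}`, so `e^{ixξ}` corresponds to the argument `-x/(2π)`; the
  -- Jacobian of this scaling is the factor `2π`.
  have hc : (-(2 * Real.pi)⁻¹ : ℝ) ≠ 0 := by simp [hpi.ne']
  have e : ∀ x : ℝ, ∫ ξ : ℝ, Complex.exp (Complex.I * x * ξ) * g ξ =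
      𝓕 g (-(2 * Real.pi)⁻¹ * x) := by
    intro x
    rw [Real.fourier_real_eq_integral_exp_smul]
    congr 1 with ξ
    rw [smul_eq_mul]
    congr 2
    push_cast
    field_simp
  have hcont : Continuous (𝓕 g) :=
    VectorFourier.fourierIntegral_continuous Real.continuous_fourierChar
      (by exact continuous_inner) h1
  simp_rw [e]
  rw [← lintegral_enorm_fourier_sq h1 h2,
    ← lintegral_map (f := fun y => ‖𝓕 g y‖ₑ ^ 2) (g := fun x => -(2 * Real.pi)⁻¹ * x)
      (by fun_prop) (by fun_prop),
    Real.map_volume_mul_left hc, lintegral_smul_measure]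
  congr 2
  rw [inv_neg, inv_inv, abs_neg, abs_of_pos (by positivity)]

/-- **Fourier inversion** in the normalisation `B(ξ) = ∫ G(x) e^{-ixξ} dx`. -/
theorem integral_cexp_mul_integral_cexp_neg {G : ℝ → ℂ} (hc : Continuous G) (hG : Integrable G)
    (hB : Integrable fun ξ : ℝ => ∫ x : ℝ, G x * Complex.exp (-(Complex.I * x * ξ))) (u : ℝ) :
    ∫ ξ : ℝ, Complex.exp (Complex.I * u * ξ) *
      ∫ x : ℝ, G x * Complex.exp (-(Complex.I * x * ξ)) = 2 * Real.pi * G u := by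
  have hpi := Real.pi_pos
  have hc0 : (2 * Real.pi : ℝ) ≠ 0 := by positivity
  have e : ∀ ξ : ℝ, 𝓕 G ξ =
      ∫ x : ℝ, G x * Complex.exp (-(Complex.I * x * (2 * Real.pi * ξ : ℝ))) := by
    intro ξ
    rw [Real.fourier_real_eq_integral_exp_smul]
    congr 1 with x
    rw [smul_eq_mul, mul_comm]
    congr 2
    push_cast
    ring
  have hF : Integrable (𝓕 G) := by
    have := hB.comp_mul_left' hc0
    refine this.congr (Eventually.of_forall fun ξ => ?_)
    rw [e]
  have inv := congrFun (hc.fourierInv_fourier_eq hG hF) u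
  rw [Real.fourierInv_eq'] at inv
  have := Measure.integral_comp_mul_left (fun ξ : ℝ => Complex.exp (Complex.I * u * ξ) *
      ∫ x : ℝ, G x * Complex.exp (-(Complex.I * x * ξ))) (2 * Real.pi)
  have h3 : ∫ ξ : ℝ, Complex.exp (Complex.I * u * (2 * Real.pi * ξ : ℝ)) *
      ∫ x : ℝ, G x * Complex.exp (-(Complex.I * x * (2 * Real.pi * ξ : ℝ))) = G u := by
    rw [← inv]
    congr 1 with ξ
    rw [← e, smul_eq_mul]
    congr 2
    simp
    ring
  rw [h3, abs_of_pos (by positivity)] at this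
  rw [this, Complex.real_smul]
  push_cast
  field_simp

end

/-! ### Mean value inequality and contour shifts in a strip. -/

section

open scoped ENNReal Topology Interval
open Filter

/-- The mean value inequality over a disc for holomorphic functions. -/
theorem enorm_mul_le_lintegral_ball {F : ℂ → ℂ} {c : ℂ} {R : ℝ} (hR : 0 < R)
    (hF : DifferentiableOn ℂ F (Metric.ball c R)) :
    ENNReal.ofReal (Real.pi * R ^ 2) * ‖F c‖ₑ ≤ ∫⁻ z in Metric.ball c R, ‖F z‖ₑ := by
  have hpi := Real.pi_pos
  have hcirc : ∀ r ∈ Set.Ioo 0 R, ENNReal.ofReal (2 * Real.pi) * ‖F c‖ₑ ≤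
      ∫⁻ θ in Set.Ioo (-Real.pi) Real.pi, ‖F (circleMap c r θ)‖ₑ := by
    intro r hr
    have hsub : Metric.closedBall c |r| ⊆ Metric.ball c R :=
      Metric.closedBall_subset_ball (by rw [abs_of_pos hr.1]; exact hr.2)
    have hav := DiffContOnCl.circleAverage (f := F) (c := c) (R := r)
      ((hF.mono hsub).diffContOnCl_ball le_rfl)
    -- The circle average runs over `[0, 2π]`, polar coordinates over `(-π, π)`; periodicity
    -- reconciles them.
    have hper : ∫ θ in (-Real.pi)..Real.pi, F (circleMap c r θ) = 2 * Real.pi * F c := by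
      have := ((periodic_circleMap c r).comp F).intervalIntegral_add_eq (-Real.pi) 0
      simp only [Function.comp_def, zero_add] at this
      rw [show -Real.pi + 2 * Real.pi = Real.pi by ring] at this
      rw [this, ← hav, Real.circleAverage, Complex.real_smul]
      push_cast
      field_simp
    have h1 : ‖(2 * Real.pi * F c : ℂ)‖ₑ ≤
        ∫⁻ θ in Set.Ioo (-Real.pi) Real.pi, ‖F (circleMap c r θ)‖ₑ := by
      rw [← hper, intervalIntegral.integral_of_le (by linarith), restrict_Ioo_eq_restrict_Ioc]
      exact enorm_integral_le_lintegral_enorm _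
    refine le_trans (le_of_eq ?_) h1
    rw [enorm_mul]
    congr 1
    rw [show (2 * Real.pi : ℂ) = ((2 * Real.pi : ℝ) : ℂ) by push_cast; ring,
      ← ofReal_norm, Complex.norm_real, Real.norm_of_nonneg (by positivity)]
  have hmeas : Measurable (fun z => (Metric.ball c R).indicator (fun z => ‖F z‖ₑ) z) := by
    classical
    rw [show (fun z => (Metric.ball c R).indicator (fun z => ‖F z‖ₑ) z) =
      (Metric.ball c R).piecewise (fun z => ‖F z‖ₑ) 0 from (Set.piecewise_eq_indicator).symm]
    exact hF.continuousOn.enorm.measurable_piecewise continuousOn_const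
      Metric.isOpen_ball.measurableSet
  rw [← lintegral_indicator Metric.isOpen_ball.measurableSet,
    ← lintegral_add_left_eq_self _ c, ← Complex.lintegral_comp_polarCoord_symm]
  have htarget : polarCoord.target = Set.Ioi (0 : ℝ) ×ˢ Set.Ioo (-Real.pi) Real.pi := rfl
  rw [htarget, Measure.volume_eq_prod, ← Measure.prod_restrict, lintegral_prod]
  · calc ENNReal.ofReal (Real.pi * R ^ 2) * ‖F c‖ₑ
        = ∫⁻ r in Set.Ioo 0 R, ENNReal.ofReal r * (ENNReal.ofReal (2 * Real.pi) * ‖F c‖ₑ) := by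
          have hint : ∫⁻ r in Set.Ioo 0 R, ENNReal.ofReal r = ENNReal.ofReal (R ^ 2 / 2) := by
            rw [← ofReal_integral_eq_lintegral_ofReal]
            · rw [restrict_Ioo_eq_restrict_Ioc, ← intervalIntegral.integral_of_le hR.le,
                integral_id]
              simp
            · exact continuous_id.integrableOn_Icc.mono_set Set.Ioo_subset_Icc_self
            · filter_upwards [ae_restrict_mem measurableSet_Ioo] with r hr
              exact hr.1.le
          rw [lintegral_mul_const _ (by fun_prop), hint, ← mul_assoc,
            ← ENNReal.ofReal_mul (by positivity)]
          congr 2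
          ring
      _ ≤ ∫⁻ r in Set.Ioo 0 R, ENNReal.ofReal r *
            ∫⁻ θ in Set.Ioo (-Real.pi) Real.pi, ‖F (circleMap c r θ)‖ₑ := by
          refine setLIntegral_mono' measurableSet_Ioo fun r hr => ?_
          gcongr
          exact hcirc r hr
      _ ≤ ∫⁻ r in Set.Ioi 0, ∫⁻ θ in Set.Ioo (-Real.pi) Real.pi, ENNReal.ofReal r •
            (Metric.ball c R).indicator (fun z => ‖F z‖ₑ)
              (c + Complex.polarCoord.symm (r, θ)) := by
          refine le_trans (setLIntegral_mono' measurableSet_Ioo fun r hr => ?_)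
            (lintegral_mono_set Set.Ioo_subset_Ioi_self)
          simp only [smul_eq_mul]
          rw [lintegral_const_mul' _ _ ENNReal.ofReal_ne_top]
          gcongr with θ
          have : c + Complex.polarCoord.symm (r, θ) = circleMap c r θ := by
            rw [circleMap, Complex.polarCoord_symm_apply, Complex.exp_mul_I]
            push_cast
            rfl
          rw [this, Set.indicator_of_mem]
          rw [Metric.mem_ball, dist_eq_norm, circleMap_sub_center, norm_circleMap_zero]
          rw [abs_of_pos hr.1]; exact hr.2
  · refine Measurable.aemeasurable ?_
    simp only [smul_eq_mul, Complex.polarCoord_symm_apply]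
    refine Measurable.mul (by fun_prop) (hmeas.comp ?_)
    fun_prop

/-- Local Gaussian decay on horizontal lines of the strip `|Im z| < β`. -/
noncomputable def HasGaussianDecay (β ε : ℝ) (G : ℂ → ℂ) : Prop :=
  ∀ y₀, |y₀| < β → ∃ δ > 0, ∃ C, ∀ z : ℂ, |z.im - y₀| < δ → |z.im| < β →
    ‖G z‖ ≤ C * Real.exp (-ε * z.re ^ 2)

theorem continuous_horizontal {β : ℝ} {G : ℂ → ℂ} (hG : ContinuousOn G {z | |z.im| < β})
    {y : ℝ} (hy : |y| < β) : Continuous fun x : ℝ => G (x + y * Complex.I) :=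
  hG.comp_continuous (by fun_prop) fun x => by simpa using hy

theorem HasGaussianDecay.integrable {β ε : ℝ} (hε : 0 < ε) {G : ℂ → ℂ}
    (hdec : HasGaussianDecay β ε G) (hG : ContinuousOn G {z | |z.im| < β})
    {y : ℝ} (hy : |y| < β) : Integrable fun x : ℝ => G (x + y * Complex.I) := by
  obtain ⟨δ, hδ, C, hC⟩ := hdec y hy
  refine ((integrable_exp_neg_mul_sq hε).const_mul C).mono'
    (continuous_horizontal hG hy).aestronglyMeasurable (Eventually.of_forall fun x => ?_)
  simpa using hC (x + y * Complex.I) (by simpa using hδ) (by simpa using hy)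

/-- Cauchy's theorem on the rectangle `[-T, T] × [y₁, y₂]`; the vertical sides vanish as `T → ∞`.
Both heights lie in one window so that a single Gaussian bound covers these sides. -/
theorem HasGaussianDecay.integral_eq_of_near {β ε : ℝ} (hε : 0 < ε) {G : ℂ → ℂ}
    (hdec : HasGaussianDecay β ε G) (hG : DifferentiableOn ℂ G {z | |z.im| < β})
    {δ C y₁ y₂ y₀ : ℝ} (hC : ∀ z : ℂ, |z.im - y₀| < δ → |z.im| < β →
      ‖G z‖ ≤ C * Real.exp (-ε * z.re ^ 2))
    (h1 : |y₁ - y₀| < δ) (h2 : |y₂ - y₀| < δ) (h1' : |y₁| < β) (h2' : |y₂| < β) :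
    ∫ x : ℝ, G (x + y₁ * Complex.I) = ∫ x : ℝ, G (x + y₂ * Complex.I) := by
  have hseg : ∀ y ∈ [[y₁, y₂]], |y - y₀| < δ ∧ |y| < β := by
    intro y hy
    rw [abs_lt] at *
    rw [abs_lt] at *
    rcases Set.mem_uIcc.1 hy with h | h <;> constructor <;> constructor <;> linarith
  have hrect : ∀ T : ℝ, (∫ x in (-T)..T, G (x + y₁ * Complex.I)) -
      (∫ x in (-T)..T, G (x + y₂ * Complex.I)) =
      Complex.I • (∫ y in y₁..y₂, G ((-T : ℝ) + y * Complex.I)) -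
        Complex.I • (∫ y in y₁..y₂, G (T + y * Complex.I)) := by
    intro T
    have := Complex.integral_boundary_rect_eq_zero_of_differentiableOn G
      (⟨-T, y₁⟩ : ℂ) ⟨T, y₂⟩ (hG.mono fun z hz => (hseg z.im hz.2).2)
    simp only at this
    linear_combination this
  have hvert : ∀ s : ℝ → ℝ, (∀ T, (s T) ^ 2 = T ^ 2) →
      Tendsto (fun T : ℝ => Complex.I • ∫ y in y₁..y₂, G (s T + y * Complex.I)) atTop (𝓝 0) := by
    intro s hs
    have hb : ∀ T : ℝ, ‖Complex.I • ∫ y in y₁..y₂, G (s T + y * Complex.I)‖ ≤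
        C * Real.exp (-ε * T ^ 2) * |y₂ - y₁| := by
      intro T
      rw [norm_smul, Complex.norm_I, one_mul]
      refine intervalIntegral.norm_integral_le_of_norm_le_const fun y hy => ?_
      have := hseg y (Set.uIoc_subset_uIcc hy)
      simpa [hs] using hC (s T + y * Complex.I) (by simpa using this.1) (by simpa using this.2)
    refine squeeze_zero_norm hb ?_
    have : Tendsto (fun T : ℝ => Real.exp (-ε * T ^ 2)) atTop (𝓝 0) := by
      refine Real.tendsto_exp_atBot.comp ?_
      exact (tendsto_pow_atTop two_ne_zero).const_mul_atTop_of_neg (by linarith)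
    simpa using (this.const_mul C).mul_const |y₂ - y₁|
  have hlim := fun {y : ℝ} (hy : |y| < β) => intervalIntegral_tendsto_integral
    (hdec.integrable hε hG.continuousOn hy) tendsto_neg_atTop_atBot tendsto_id
  have hl := (hlim h1').sub (hlim h2')
  have hr := (hvert (fun T => -T) (by simp)).sub (hvert id (by simp))
  simp only [id, sub_zero] at hl hr
  simp_rw [hrect] at hl
  exact sub_eq_zero.1 (tendsto_nhds_unique hl hr)

/-- The integral over a horizontal line does not depend on the line. -/
theorem HasGaussianDecay.integral_eq {β ε : ℝ} (hε : 0 < ε) {G : ℂ → ℂ}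
    (hdec : HasGaussianDecay β ε G) (hG : DifferentiableOn ℂ G {z | |z.im| < β})
    {y₁ y₂ : ℝ} (h1 : |y₁| < β) (h2 : |y₂| < β) :
    ∫ x : ℝ, G (x + y₁ * Complex.I) = ∫ x : ℝ, G (x + y₂ * Complex.I) := by
  set Φ : ℝ → ℂ := fun y => ∫ x : ℝ, G (x + y * Complex.I)
  -- The local statement makes `Φ` locally constant; connectedness of the interval globalises it.
  have hderiv : ∀ y ∈ Set.Ioo (-β) β, HasDerivAt Φ 0 y := by
    intro y hy
    have hy' : |y| < β := abs_lt.2 hy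
    obtain ⟨δ, hδ, C, hC⟩ := hdec y hy'
    refine (hasDerivAt_const y (Φ y)).congr_of_eventuallyEq ?_
    filter_upwards [Ioo_mem_nhds hy.1 hy.2, Metric.ball_mem_nhds y hδ] with t ht ht'
    exact hdec.integral_eq_of_near hε hG hC (by simpa [Real.dist_eq] using ht') (by simpa using hδ)
      (abs_lt.2 ht) hy'
  exact isOpen_Ioo.is_const_of_deriv_eq_zero isPreconnected_Ioo
    (fun y hy => (hderiv y hy).differentiableAt.differentiableWithinAt)
    (fun y hy => (hderiv y hy).deriv) (abs_lt.1 h1) (abs_lt.1 h2)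

end

/-! ### Decay of the multiplier and regularity of `H_j`. -/

section

open scoped ENNReal Topology
open Filter ProbabilityTheory

theorem integrable_exp_neg_mul_abs {ρ : ℝ} (hρ : 0 < ρ) :
    Integrable fun x : ℝ => Real.exp (-ρ * |x|) := by
  rw [← integrableOn_univ, ← Set.Iic_union_Ioi (a := (0 : ℝ))]
  refine IntegrableOn.union ?_ ?_
  · refine (integrableOn_exp_mul_Iic hρ 0).congr_fun (fun x hx => ?_) measurableSet_Iic
    simp [abs_of_nonpos (Set.mem_Iic.1 hx)]
  · refine (integrableOn_exp_mul_Ioi (neg_neg_of_pos hρ) 0).congr_fun (fun x hx => ?_)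
      measurableSet_Ioi
    simp [abs_of_pos (Set.mem_Ioi.1 hx)]

theorem exp_mul_le_exp_mul_abs {u κ : ℝ} (h : |u| ≤ κ) (ξ : ℝ) :
    Real.exp (u * ξ) ≤ Real.exp (κ * |ξ|) :=
  Real.exp_le_exp.2 <| (le_abs_self _).trans <| (abs_mul _ _).le.trans <|
    mul_le_mul_of_nonneg_right h (abs_nonneg _)

theorem div_sinh_nonneg {b : ℝ} (hb : 0 < b) (t : ℝ) : 0 ≤ t / Real.sinh (b * t) := by
  rcases le_total 0 t with ht | ht
  · exact div_nonneg ht (Real.sinh_nonneg_iff.2 (by positivity))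
  · exact div_nonneg_of_nonpos ht
      (Real.sinh_nonpos_iff.2 (mul_nonpos_of_nonneg_of_nonpos hb.le ht))

/-- At infinity `sinh (bt)` is comparable to `e^{bt}`, and the factor `t` is absorbed by giving up
`η` in the rate; the term `1 / b` accounts for the limit at `t = 0`. -/
theorem div_sinh_le_of_pos {b η t : ℝ} (hb : 0 < b) (hη : 0 < η) (ht : 0 < t) :
    t / Real.sinh (b * t) ≤ (1 / b + 2 / η) * Real.exp (-(b - η) * t) := by
  have hbt : 0 < b * t := by positivity
  have hs : 0 < Real.sinh (b * t) := Real.sinh_pos_iff.2 hbt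
  rw [div_le_iff₀ hs, Real.sinh_eq]
  have h1 : Real.exp (-(b - η) * t) = Real.exp (η * t) * Real.exp (-(b * t)) := by
    rw [← Real.exp_add]; congr 1; ring
  have h2 : Real.exp (-(b * t)) * Real.exp (b * t) = 1 := by rw [← Real.exp_add]; simp
  have h3 : 1 + η * t ≤ Real.exp (η * t) := by linarith [Real.add_one_le_exp (η * t)]
  -- With `s = 2bt`, the inequality `1 + s ≤ eˢ` gives `s ≤ (1 + s)(1 - e^{-s})`, which bounds
  -- `sinh` from below.
  have h4 : (1 + 2 * (b * t)) * Real.exp (-(2 * (b * t))) ≤ 1 := by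
    have := Real.add_one_le_exp (2 * (b * t))
    calc _ ≤ Real.exp (2 * (b * t)) * Real.exp (-(2 * (b * t))) := by gcongr; linarith
      _ = 1 := by rw [← Real.exp_add]; simp
  have h5 : Real.exp (-(b * t)) * Real.exp (-(b * t)) = Real.exp (-(2 * (b * t))) := by
    rw [← Real.exp_add]; congr 1; ring
  have h6 : 2 * (b * t) ≤ (1 + 2 * (b * t)) * (1 - Real.exp (-(2 * (b * t)))) := by linarith
  have h7 : (1 + 2 * (b * t)) ≤ b * (1 / b + 2 / η) * Real.exp (η * t) := by
    refine le_trans ?_ (mul_le_mul_of_nonneg_left h3 (by positivity))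
    have : b * (1 / b + 2 / η) * (1 + η * t) = 1 + 2 * (b * t) + 2 * b / η + η * t := by
      field_simp; ring
    rw [this]
    have : 0 < 2 * b / η + η * t := by positivity
    linarith
  have hE : Real.exp (-(2 * (b * t))) ≤ 1 := Real.exp_le_one_iff.2 (by linarith)
  have h8 : 2 * (b * t) ≤ b * (1 / b + 2 / η) * Real.exp (η * t) *
      (1 - Real.exp (-(2 * (b * t)))) :=
    h6.trans (mul_le_mul_of_nonneg_right h7 (by linarith))
  have h9 : (1 / b + 2 / η) * Real.exp (-(b - η) * t) *
      ((Real.exp (b * t) - Real.exp (-(b * t))) / 2) =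
      (b * (1 / b + 2 / η) * Real.exp (η * t) * (1 - Real.exp (-(2 * (b * t))))) / (2 * b) := by
    rw [h1, ← h5]
    have : Real.exp (η * t) * Real.exp (-(b * t)) * (Real.exp (b * t) - Real.exp (-(b * t))) =
      Real.exp (η * t) * (1 - Real.exp (-(b * t)) * Real.exp (-(b * t))) := by
      linear_combination Real.exp (η * t) * h2
    rw [mul_div_assoc', mul_assoc, this]
    field_simp
  rw [h9, le_div_iff₀ (by positivity)]
  linarith

theorem div_sinh_le {b η : ℝ} (hb : 0 < b) (hη : 0 < η) (t : ℝ) :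
    t / Real.sinh (b * t) ≤ (1 / b + 2 / η) * Real.exp (-(b - η) * |t|) := by
  rcases lt_trichotomy t 0 with ht | rfl | ht
  · have := div_sinh_le_of_pos hb hη (neg_pos.2 ht)
    rwa [mul_neg, Real.sinh_neg, neg_div_neg_eq, ← abs_of_neg ht] at this
  · simp; positivity
  · rw [abs_of_pos ht]; exact div_sinh_le_of_pos hb hη ht

/-- The Fourier multiplier `ξ (ξ - (j+1)/2) / (sinh (πξ) sinh ((2β-π)(ξ - (j+1)/2)))`. -/
noncomputable def multiplier (β : ℝ) (j : ℤ) (ξ : ℝ) : ℝ :=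
  ξ / Real.sinh (Real.pi * ξ) *
    ((ξ - ((j : ℝ) + 1) / 2) / Real.sinh ((2 * β - Real.pi) * (ξ - ((j : ℝ) + 1) / 2)))

theorem kernelIntegrand_eq (β : ℝ) (j : ℤ) (z w : ℂ) (ξ : ℝ) :
    kernelIntegrand β j z w ξ =
      Complex.exp (Complex.I * (z - starRingEnd ℂ w) * ξ) * multiplier β j ξ := by
  rw [kernelIntegrand, multiplier, mul_div_assoc, div_mul_div_comm]
  push_cast
  rfl

theorem measurable_multiplier (β : ℝ) (j : ℤ) : Measurable (multiplier β j) := by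
  unfold multiplier
  have h := Real.continuous_sinh.measurable
  exact (measurable_id.div (h.comp (by fun_prop))).mul
    ((measurable_id.sub_const _).div (h.comp (by fun_prop)))

theorem multiplier_nonneg {β : ℝ} (hβ : Real.pi / 2 < β) (j : ℤ) (ξ : ℝ) :
    0 ≤ multiplier β j ξ :=
  mul_nonneg (div_sinh_nonneg Real.pi_pos _) (div_sinh_nonneg (by linarith) _)

/-- The rates `π` and `2β - π` of the two factors add up to `2β`; the shift of the second factor
costs only a constant. -/
theorem multiplier_le {β : ℝ} (hβ : Real.pi / 2 < β) (j : ℤ) {ρ : ℝ} (hρ : ρ < 2 * β) :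
    ∃ C, 0 ≤ C ∧ ∀ ξ, multiplier β j ξ ≤ C * Real.exp (-ρ * |ξ|) := by
  have hpi := Real.pi_pos
  set a : ℝ := ((j : ℝ) + 1) / 2 with ha
  -- Each factor loses `η`, so `2β - 2η ≥ ρ` is needed; `η < 2β - π` keeps the second rate positive,
  -- as the triangle inequality for `|ξ - a|` requires.
  obtain ⟨η, hη, hη1, hη2⟩ : ∃ η, 0 < η ∧ η ≤ β - ρ / 2 ∧ η < 2 * β - Real.pi :=
    ⟨min (β - ρ / 2) ((2 * β - Real.pi) / 2), lt_min (by linarith) (by linarith),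
      min_le_left _ _, (min_le_right _ _).trans_lt (by linarith)⟩
  set C₁ := 1 / Real.pi + 2 / η
  set C₂ := 1 / (2 * β - Real.pi) + 2 / η
  have hb : 0 < 2 * β - Real.pi := by linarith
  have hC₁ : 0 < C₁ := by positivity
  have hC₂ : 0 < C₂ := by positivity
  refine ⟨C₁ * C₂ * Real.exp ((2 * β - Real.pi - η) * |a|), by positivity, fun ξ => ?_⟩
  calc multiplier β j ξ ≤ (C₁ * Real.exp (-(Real.pi - η) * |ξ|)) *
        (C₂ * Real.exp (-(2 * β - Real.pi - η) * |ξ - a|)) :=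
        mul_le_mul (div_sinh_le hpi hη ξ) (div_sinh_le hb hη _) (div_sinh_nonneg hb _)
          (by positivity)
    _ = C₁ * C₂ * Real.exp (-(Real.pi - η) * |ξ| + -(2 * β - Real.pi - η) * |ξ - a|) := by
        rw [Real.exp_add]; ring
    _ ≤ C₁ * C₂ * Real.exp ((2 * β - Real.pi - η) * |a| + -ρ * |ξ|) := by
        refine mul_le_mul_of_nonneg_left (Real.exp_le_exp.2 ?_) (by positivity)
        have h1 : |ξ| ≤ |ξ - a| + |a| := by simpa using abs_add_le (ξ - a) a
        have h2 := mul_le_mul_of_nonneg_left h1 (by linarith : 0 ≤ 2 * β - Real.pi - η)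
        have h3 := mul_le_mul_of_nonneg_right (by linarith : ρ ≤ 2 * β - 2 * η) (abs_nonneg ξ)
        linarith
    _ = _ := by rw [Real.exp_add]; ring

theorem integrable_exp_mul_multiplier {β : ℝ} (hβ : Real.pi / 2 < β) (j : ℤ) {t : ℝ}
    (ht : |t| < 2 * β) : Integrable fun ξ => Real.exp (t * ξ) * multiplier β j ξ := by
  obtain ⟨ρ, h1, h2⟩ := exists_between ht
  obtain ⟨C, hC0, hC⟩ := multiplier_le hβ j h2
  refine ((integrable_exp_neg_mul_abs (sub_pos.2 h1)).const_mul C).mono'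
    ((by fun_prop : Measurable fun ξ => Real.exp (t * ξ)).mul
      (measurable_multiplier β j)).aestronglyMeasurable (Eventually.of_forall fun ξ => ?_)
  rw [Real.norm_of_nonneg (mul_nonneg (Real.exp_nonneg _) (multiplier_nonneg hβ j ξ))]
  calc _ ≤ Real.exp (|t| * |ξ|) * (C * Real.exp (-ρ * |ξ|)) := by
        exact mul_le_mul (exp_mul_le_exp_mul_abs le_rfl ξ) (hC ξ)
          (multiplier_nonneg hβ j ξ) (Real.exp_nonneg _)
    _ = _ := by
        rw [mul_left_comm, ← Real.exp_add]; congr 2; ring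

theorem norm_kernelIntegrand {β : ℝ} (hβ : Real.pi / 2 < β) (j : ℤ) (z w : ℂ) (ξ : ℝ) :
    ‖kernelIntegrand β j z w ξ‖ = Real.exp (-(z.im + w.im) * ξ) * multiplier β j ξ := by
  rw [kernelIntegrand_eq, norm_mul, Complex.norm_exp, Complex.norm_real,
    Real.norm_of_nonneg (multiplier_nonneg hβ j ξ)]
  congr 2
  simp

theorem measurable_kernelIntegrand (β : ℝ) (j : ℤ) (z w : ℂ) :
    Measurable (kernelIntegrand β j z w) := by
  simp_rw [funext (kernelIntegrand_eq β j z w)]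
  exact (by fun_prop : Measurable fun ξ : ℝ =>
    Complex.exp (Complex.I * (z - starRingEnd ℂ w) * ξ)).mul
      (Complex.measurable_ofReal.comp (measurable_multiplier β j))

theorem integrable_kernelIntegrand {β : ℝ} (hβ : Real.pi / 2 < β) (j : ℤ) {z w : ℂ}
    (h : |z.im + w.im| < 2 * β) : Integrable (kernelIntegrand β j z w) := by
  rw [← integrable_norm_iff (measurable_kernelIntegrand β j z w).aestronglyMeasurable]
  simp_rw [norm_kernelIntegrand hβ]
  exact integrable_exp_mul_multiplier hβ j (by rwa [abs_neg])

/-- Up to a constant, `H_j` is the complex moment generating function of the positive measure with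
density `multiplier β j`, taken at `i(z - w̄)`; such a function is holomorphic over the interior of
its integrability set. -/
theorem differentiableOn_kernelFactor {β : ℝ} (hβ : Real.pi / 2 < β) (j : ℤ) (w : ℂ) :
    DifferentiableOn ℂ (fun z => kernelFactor β j z w) {z | |z.im + w.im| < 2 * β} := by
  set f : ℝ → NNReal := fun ξ => (multiplier β j ξ).toNNReal
  have hf : Measurable f := (measurable_multiplier β j).real_toNNReal
  set μ : Measure ℝ := volume.withDensity fun ξ => (f ξ : ℝ≥0∞)
  have hset : Set.Ioo (-(2 * β)) (2 * β) ⊆ interior (integrableExpSet id μ) := by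
    refine interior_maximal (fun t ht => ?_) isOpen_Ioo
    rw [integrableExpSet, Set.mem_ofPred_eq, integrable_withDensity_iff_integrable_smul hf]
    refine (integrable_exp_mul_multiplier hβ j (abs_lt.2 ht)).congr
      (Eventually.of_forall fun ξ => ?_)
    simp [f, NNReal.smul_def, multiplier_nonneg hβ j ξ, mul_comm]
  have heq : (fun z => kernelFactor β j z w) = fun z => 1 / (2 * (Real.pi : ℂ) ^ 2) *
      complexMGF id μ (Complex.I * (z - starRingEnd ℂ w)) := by
    funext z
    rw [kernelFactor, complexMGF, integral_withDensity_eq_integral_smul hf]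
    congr 2 with ξ
    simp [f, NNReal.smul_def, multiplier_nonneg hβ j ξ, kernelIntegrand_eq, mul_comm]
  rw [heq]
  refine DifferentiableOn.const_mul ?_ _
  refine (differentiableOn_complexMGF (X := id) (μ := μ)).comp (by fun_prop) fun z hz => ?_
  apply hset
  have hz' : |z.im + w.im| < 2 * β := hz
  have := abs_lt.1 hz'
  simp
  constructor <;> linarith

/-- The kernel factor is square integrable on horizontal lines, uniformly in the line. -/
theorem exists_lintegral_enorm_kernelFactor_sq_le {β : ℝ} (hβ : Real.pi / 2 < β) (j : ℤ) {w : ℂ}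
    (hw : |w.im| < β) : ∃ M : ℝ≥0∞, M ≠ ∞ ∧ ∀ y : ℝ, |y| < β →
      ∫⁻ x : ℝ, ‖kernelFactor β j (x + y * Complex.I) w‖ₑ ^ 2 ≤ M := by
  -- A rate `ρ` above `β + |Im w|` beats the growth `e^{-(y + Im w)ξ}` for all heights `|y| < β` at
  -- once, with margin `τ`.
  obtain ⟨ρ, h1, h2⟩ := exists_between (by linarith : β + |w.im| < 2 * β)
  obtain ⟨C, hC0, hC⟩ := multiplier_le hβ j h2
  set τ := ρ - (β + |w.im|) with hτ
  have hτ0 : 0 < τ := sub_pos.2 h1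
  set k : ℝ≥0∞ := ‖(1 / (2 * (Real.pi : ℂ) ^ 2) : ℂ)‖ₑ
  have hk : k ^ 2 ≠ ∞ := ENNReal.pow_ne_top enorm_ne_top
  set N : ℝ≥0∞ := ∫⁻ ξ : ℝ, ENNReal.ofReal (C ^ 2 * Real.exp (-(2 * τ) * |ξ|))
  have hN : N ≠ ∞ :=
    ((integrable_exp_neg_mul_abs (by positivity : 0 < 2 * τ)).const_mul (C ^ 2)).lintegral_lt_top.ne
  refine ⟨k ^ 2 * (ENNReal.ofReal (2 * Real.pi) * N), ?_, fun y hy => ?_⟩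
  · exact ENNReal.mul_ne_top hk (ENNReal.mul_ne_top ENNReal.ofReal_ne_top hN)
  set g : ℝ → ℂ := fun ξ => kernelIntegrand β j (y * Complex.I) w ξ
  have hgm : Measurable g := measurable_kernelIntegrand β j _ w
  have hgint : Integrable g := by
    refine integrable_kernelIntegrand hβ j ?_
    have := abs_add_le y w.im
    simp only [Complex.mul_im, Complex.ofReal_re, Complex.I_im, Complex.ofReal_im, Complex.I_re,
      mul_one, mul_zero, add_zero]
    linarith
  have hgb : ∀ ξ, ‖g ξ‖ ≤ C * Real.exp (-τ * |ξ|) := by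
    intro ξ
    rw [norm_kernelIntegrand hβ]
    calc _ ≤ Real.exp ((β + |w.im|) * |ξ|) * (C * Real.exp (-ρ * |ξ|)) := by
          refine mul_le_mul (exp_mul_le_exp_mul_abs ?_ ξ) (hC ξ)
            (multiplier_nonneg hβ j ξ) (Real.exp_nonneg _)
          rw [abs_neg]
          refine (abs_add_le _ _).trans (add_le_add_left ?_ _)
          simpa using hy.le
      _ = _ := by rw [mul_left_comm, ← Real.exp_add]; congr 2; rw [hτ]; ring
  have hgN : ∫⁻ ξ, ‖g ξ‖ₑ ^ 2 ≤ N := by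
    refine lintegral_mono fun ξ => ?_
    rw [← ofReal_norm, ← ENNReal.ofReal_pow (norm_nonneg _)]
    refine ENNReal.ofReal_le_ofReal ?_
    refine (pow_le_pow_left₀ (norm_nonneg _) (hgb ξ) 2).trans (le_of_eq ?_)
    rw [mul_pow, ← Real.exp_nat_mul]
    congr 2
    push_cast
    ring
  have hg2 : MemLp g 2 := by
    refine ⟨hgm.aestronglyMeasurable, ?_⟩
    rw [eLpNorm_lt_top_iff_lintegral_rpow_enorm_lt_top two_ne_zero ENNReal.ofNat_ne_top]
    simpa using hgN.trans_lt hN.lt_top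
  calc ∫⁻ x : ℝ, ‖kernelFactor β j (x + y * Complex.I) w‖ₑ ^ 2
      = ∫⁻ x : ℝ, k ^ 2 * ‖∫ ξ : ℝ, Complex.exp (Complex.I * x * ξ) * g ξ‖ₑ ^ 2 := by
        congr 1 with x
        rw [kernelFactor, enorm_mul, mul_pow]
        congr 4 with ξ
        simp only [g]
        rw [kernelIntegrand_eq, kernelIntegrand_eq, ← mul_assoc, ← Complex.exp_add]
        congr 2
        ring
    _ = k ^ 2 * (ENNReal.ofReal (2 * Real.pi) * ∫⁻ ξ, ‖g ξ‖ₑ ^ 2) := by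
        rw [lintegral_const_mul' _ _ hk, lintegral_enorm_integral_cexp_mul_sq hgint hg2]
    _ ≤ _ := by gcongr

end

/-! ### Geometry of the domain and separation of variables. -/

section

open scoped ENNReal Topology
open Filter

theorem isOpen_wormDomain (β : ℝ) : IsOpen (wormDomain β) := by
  have h1 : IsOpen {z : ℂ × ℂ | z.2 ≠ 0} := isOpen_ne_fun continuous_snd continuous_const
  have hlog : ContinuousOn (fun z : ℂ × ℂ => Real.log (‖z.2‖ ^ 2)) {z | z.2 ≠ 0} :=
    ContinuousOn.log (by fun_prop) fun z hz => by simpa using hz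
  have hcont : ContinuousOn (fun z : ℂ × ℂ =>
      (|z.1.im - Real.log (‖z.2‖ ^ 2)|, |Real.log (‖z.2‖ ^ 2)|)) {z | z.2 ≠ 0} :=
    ((Complex.continuous_im.comp continuous_fst).continuousOn.sub hlog).abs.prodMk hlog.abs
  have := hcont.isOpen_inter_preimage h1
    ((isOpen_Iio (a := Real.pi / 2)).prod (isOpen_Iio (a := β - Real.pi / 2)))
  convert! this using 1

theorem abs_im_lt_of_mem_wormDomain {β : ℝ} {z : ℂ × ℂ} (hz : z ∈ wormDomain β) :
    |z.1.im| < β := by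
  have h1 := abs_lt.1 hz.2.1
  have h2 := abs_lt.1 hz.2.2
  exact abs_lt.2 ⟨by linarith, by linarith⟩

/-- The point of the positive real axis used as a section of `D'_β → strip`. -/
noncomputable def wormSection (β : ℝ) (y : ℝ) : ℝ := Real.exp ((β - Real.pi / 2) * y / β / 2)

theorem log_norm_exp_sq (t : ℂ) : Real.log (‖Complex.exp t‖ ^ 2) = 2 * t.re := by
  rw [Complex.norm_exp, Real.log_pow, Real.log_exp]; norm_num

/-- The section has `log |z₂|² = (β - π/2)/β · Im z`, leaving `Im z - log |z₂|² = (π/2)/β · Im z`;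
both bounds reduce to `|Im z| < β`. -/
theorem wormSection_mem {β : ℝ} (hβ : Real.pi / 2 < β) {z : ℂ} (hz : |z.im| < β) :
    (z, (wormSection β z.im : ℂ)) ∈ wormDomain β := by
  have hpi := Real.pi_pos
  have hβ0 : 0 < β := by linarith
  have hlog : Real.log (‖((wormSection β z.im : ℝ) : ℂ)‖ ^ 2) =
      (β - Real.pi / 2) / β * z.im := by
    rw [wormSection, Complex.ofReal_exp, log_norm_exp_sq, Complex.ofReal_re]; ring
  refine ⟨by simp [wormSection], ?_, ?_⟩
  · simp only [hlog]
    have : z.im - (β - Real.pi / 2) / β * z.im = Real.pi / 2 / β * z.im := by field_simp; ring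
    rw [this, abs_mul, abs_of_pos (by positivity)]
    calc _ < Real.pi / 2 / β * β := by gcongr
      _ = _ := by field_simp
  · simp only [hlog]
    have h0 : 0 < β - Real.pi / 2 := by linarith
    rw [abs_mul, abs_of_pos (by positivity)]
    calc _ < (β - Real.pi / 2) / β * β := by gcongr
      _ = _ := by field_simp

/-- A rotationally equivariant holomorphic function on the worm domain is constant along the
fibres after division by `z₂ ^ j`. -/
theorem eq_of_rotational {β : ℝ} {j : ℤ} {f : ℂ × ℂ → ℂ}
    (hf : DifferentiableOn ℂ f (wormDomain β))
    (hrot : ∀ z ∈ wormDomain β, ∀ θ : ℝ,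
      f (z.1, Complex.exp (Complex.I * θ) * z.2) = Complex.exp (Complex.I * j * θ) * f z)
    {z₁ a b : ℂ} (ha : (z₁, a) ∈ wormDomain β) (hb : (z₁, b) ∈ wormDomain β) :
    f (z₁, a) * a ^ (-j) = f (z₁, b) * b ^ (-j) := by
  -- `S` is the fibre in the coordinate `ζ = log z₂`: a vertical strip, convex, on which rotation
  -- becomes imaginary translation.
  set S : Set ℂ := {ζ | |z₁.im - 2 * ζ.re| < Real.pi / 2 ∧ |2 * ζ.re| < β - Real.pi / 2}
  have hS : ∀ ζ, ζ ∈ S ↔ (z₁, Complex.exp ζ) ∈ wormDomain β := by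
    intro ζ
    simp [S, wormDomain, ← log_norm_exp_sq]
  have hSopen : IsOpen S := by
    have h1 : IsOpen {ζ : ℂ | |z₁.im - 2 * ζ.re| < Real.pi / 2} :=
      isOpen_lt (by fun_prop) continuous_const
    have h2 : IsOpen {ζ : ℂ | |2 * ζ.re| < β - Real.pi / 2} :=
      isOpen_lt (by fun_prop) continuous_const
    exact h1.inter h2
  have hSconv : Convex ℝ S := by
    have : S = Complex.reLm ⁻¹' ((fun t : ℝ => 2 * t) ⁻¹' (Set.Ioo (z₁.im - Real.pi / 2)
        (z₁.im + Real.pi / 2) ∩ Set.Ioo (-(β - Real.pi / 2)) (β - Real.pi / 2))) := by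
      ext ζ
      simp only [S, Set.mem_ofPred_eq, abs_lt, Set.mem_preimage, Set.mem_inter_iff, Set.mem_Ioo,
        Complex.reLm_coe]
      constructor <;> rintro ⟨⟨_, _⟩, _, _⟩ <;> refine ⟨⟨?_, ?_⟩, ?_, ?_⟩ <;> linarith
    rw [this]
    exact (((convex_Ioo _ _).inter (convex_Ioo _ _)).linear_preimage
      (LinearMap.mulLeft ℝ (2 : ℝ))).linear_preimage _
  set h : ℂ → ℂ := fun ζ => f (z₁, Complex.exp ζ) * Complex.exp (-j * ζ)
  have hdiff : DifferentiableOn ℂ h S := by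
    refine DifferentiableOn.mul ?_ (by fun_prop)
    exact hf.comp (by fun_prop) fun ζ hζ => (hS ζ).1 hζ
  have hinv : ∀ ζ ∈ S, ∀ θ : ℝ, h (ζ + θ * Complex.I) = h ζ := by
    intro ζ hζ θ
    have := hrot _ ((hS ζ).1 hζ) θ
    simp only [h]
    rw [show Complex.exp (ζ + θ * Complex.I) = Complex.exp (Complex.I * θ) * Complex.exp ζ by
      rw [← Complex.exp_add]; congr 1; ring]
    rw [this, mul_comm (Complex.exp _) (f _), mul_assoc, ← Complex.exp_add]
    congr 2
    ring
  -- The derivative of a holomorphic function is determined by any one direction; in direction `i`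
  -- it is zero.
  have hderiv : ∀ ζ ∈ S, deriv h ζ = 0 := by
    intro ζ hζ
    have h1 : HasDerivAt h (deriv h ζ) (ζ + (0 : ℝ) * Complex.I) := by
      simpa using (hdiff.differentiableAt (hSopen.mem_nhds hζ)).hasDerivAt
    have h2 : HasDerivAt (fun θ : ℝ => ζ + θ * Complex.I) Complex.I 0 := by
      simpa using (Complex.ofRealCLM.hasDerivAt.mul_const Complex.I).const_add ζ
    have h3 := h1.comp (0 : ℝ) h2
    have h4 : (h ∘ fun θ : ℝ => ζ + θ * Complex.I) = fun _ => h ζ := by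
      funext θ; exact hinv ζ hζ θ
    rw [h4] at h3
    simpa using h3.unique (hasDerivAt_const _ _)
  have hconst := fun {x y} => hSopen.is_const_of_deriv_eq_zero (x := x) (y := y)
    hSconv.isPreconnected hdiff hderiv
  have key : ∀ a : ℂ, (z₁, a) ∈ wormDomain β →
      Complex.log a ∈ S ∧ h (Complex.log a) = f (z₁, a) * a ^ (-j) := by
    intro a ha
    have ha0 : a ≠ 0 := ha.1
    refine ⟨(hS _).2 (by rwa [Complex.exp_log ha0]), ?_⟩
    simp only [h]
    rw [Complex.exp_log ha0, show -(j : ℂ) * Complex.log a = ((-j : ℤ) : ℂ) * Complex.log a by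
      push_cast; ring, Complex.exp_int_mul, Complex.exp_log ha0]
  rw [← (key a ha).2, ← (key b hb).2]
  exact hconst (key a ha).1 (key b hb).1

/-- The one-variable factor of a function in the `j`-th rotational component. -/
noncomputable def wormFactor (β : ℝ) (j : ℤ) (f : ℂ × ℂ → ℂ) (z : ℂ) : ℂ :=
  f (z, (wormSection β z.im : ℂ)) * (wormSection β z.im : ℂ) ^ (-j)

theorem eq_wormFactor_mul {β : ℝ} (hβ : Real.pi / 2 < β) {j : ℤ} {f : ℂ × ℂ → ℂ}
    (hf : DifferentiableOn ℂ f (wormDomain β))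
    (hrot : ∀ z ∈ wormDomain β, ∀ θ : ℝ,
      f (z.1, Complex.exp (Complex.I * θ) * z.2) = Complex.exp (Complex.I * j * θ) * f z)
    {z : ℂ × ℂ} (hz : z ∈ wormDomain β) : f z = wormFactor β j f z.1 * z.2 ^ j := by
  rw [wormFactor, eq_of_rotational hf hrot
    (wormSection_mem hβ (abs_im_lt_of_mem_wormDomain hz)) (b := z.2) hz, mul_assoc,
    ← zpow_add₀ hz.1]
  simp

/-- The section is not holomorphic in `z`, but constancy on fibres allows it to be frozen at a fixed
`b` near each point. -/
theorem differentiableOn_wormFactor {β : ℝ} (hβ : Real.pi / 2 < β) {j : ℤ} {f : ℂ × ℂ → ℂ}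
    (hf : DifferentiableOn ℂ f (wormDomain β))
    (hrot : ∀ z ∈ wormDomain β, ∀ θ : ℝ,
      f (z.1, Complex.exp (Complex.I * θ) * z.2) = Complex.exp (Complex.I * j * θ) * f z) :
    DifferentiableOn ℂ (wormFactor β j f) {z | |z.im| < β} := by
  intro z hz
  set b : ℂ := ((wormSection β z.im : ℝ) : ℂ)
  have hmem : (z, b) ∈ wormDomain β := wormSection_mem hβ hz
  have hev : ∀ᶠ u in 𝓝 z, (u, b) ∈ wormDomain β :=
    (by fun_prop : Continuous fun u : ℂ => (u, b)).continuousAt.eventually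
      ((isOpen_wormDomain β).mem_nhds hmem)
  have heq : wormFactor β j f =ᶠ[𝓝 z] fun u => f (u, b) * b ^ (-j) := by
    filter_upwards [hev] with u hu
    exact eq_of_rotational hf hrot (wormSection_mem hβ (abs_im_lt_of_mem_wormDomain hu)) hu
  refine (DifferentiableAt.congr_of_eventuallyEq ?_ heq).differentiableWithinAt
  refine DifferentiableAt.mul_const ?_ _
  exact (hf.differentiableAt ((isOpen_wormDomain β).mem_nhds hmem)).comp z
    (by fun_prop : DifferentiableAt ℂ (fun u : ℂ => (u, b)) z)

end

/-! ### Fubini coordinates and the Fourier weight. -/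

section

open scoped ENNReal Topology
open Filter

/-- The set of `(Im z₁, z₂)` for `z ∈ D'_β`. -/
noncomputable def wormFibre (β : ℝ) : Set (ℝ × ℂ) :=
  {p | p.2 ≠ 0 ∧ |p.1 - Real.log (‖p.2‖ ^ 2)| < Real.pi / 2 ∧
    |Real.log (‖p.2‖ ^ 2)| < β - Real.pi / 2}

/-- Lebesgue measure on `wormFibre β`. -/
noncomputable def wormMeasure (β : ℝ) : Measure (ℝ × ℂ) := volume.restrict (wormFibre β)

/-- The chart `(x, (y, z₂)) ↦ (x + iy, z₂)`. -/
noncomputable def wormChart : ℝ × ℝ × ℂ ≃ᵐ ℂ × ℂ :=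
  MeasurableEquiv.prodAssoc.symm.trans
    (Complex.measurableEquivRealProd.symm.prodCongr (MeasurableEquiv.refl ℂ))

theorem wormChart_apply (x : ℝ) (p : ℝ × ℂ) :
    wormChart (x, p) = ((x : ℂ) + (p.1 : ℂ) * Complex.I, p.2) := by
  refine Prod.ext ?_ rfl
  apply Complex.ext <;> simp [wormChart] <;> rfl

theorem measurePreserving_wormChart :
    MeasurePreserving wormChart (volume : Measure (ℝ × ℝ × ℂ)) (volume : Measure (ℂ × ℂ)) := by
  have h1 : MeasurePreserving (MeasurableEquiv.prodAssoc (α := ℝ) (β := ℝ) (γ := ℂ)).symm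
      volume volume := volume_preserving_prodAssoc.symm
  have h2 : MeasurePreserving (Prod.map Complex.measurableEquivRealProd.symm (id : ℂ → ℂ))
      (volume : Measure ((ℝ × ℝ) × ℂ)) volume :=
    Complex.volume_preserving_equiv_real_prod.symm.prod (MeasurePreserving.id volume)
  exact h2.comp h1

theorem wormChart_mem_iff {β : ℝ} (x : ℝ) (p : ℝ × ℂ) :
    wormChart (x, p) ∈ wormDomain β ↔ p ∈ wormFibre β := by
  rw [wormChart_apply]
  simp [wormDomain, wormFibre]

theorem measurableSet_wormFibre (β : ℝ) : MeasurableSet (wormFibre β) := by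
  have : wormFibre β = (fun p : ℝ × ℂ => wormChart (0, p)) ⁻¹' wormDomain β := by
    ext p; exact (wormChart_mem_iff 0 p).symm
  rw [this]
  exact (wormChart.measurable.comp (by fun_prop)) (isOpen_wormDomain β).measurableSet

theorem measurePreserving_wormChart_restrict (β : ℝ) :
    MeasurePreserving wormChart ((volume : Measure ℝ).prod (wormMeasure β))
      (volume.restrict (wormDomain β)) := by
  have h := measurePreserving_wormChart.restrict_preimage_emb wormChart.measurableEmbedding
    (wormDomain β)
  have hpre : wormChart ⁻¹' wormDomain β = Set.univ ×ˢ wormFibre β := by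
    ext ⟨x, p⟩
    simp [wormChart_mem_iff]
  rwa [hpre, Measure.volume_eq_prod, ← Measure.prod_restrict, Measure.restrict_univ] at h

theorem bounds_of_mem_wormFibre {β : ℝ} {p : ℝ × ℂ} (hp : p ∈ wormFibre β) :
    |p.1| < β ∧ ‖p.2‖ ≤ Real.exp β := by
  have h1 := abs_lt.1 hp.2.1
  have h2 := abs_lt.1 hp.2.2
  refine ⟨abs_lt.2 ⟨by linarith, by linarith⟩, ?_⟩
  have hpi := Real.pi_pos
  have h0 : 0 < ‖p.2‖ := norm_pos_iff.2 hp.1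
  rw [Real.log_pow] at h2
  rw [← Real.log_le_iff_le_exp h0]
  push_cast at h2
  linarith [h2.2, h2.1]

instance isFiniteMeasure_wormMeasure (β : ℝ) : IsFiniteMeasure (wormMeasure β) := by
  refine ⟨?_⟩
  rw [wormMeasure, Measure.restrict_apply_univ]
  refine lt_of_le_of_lt (measure_mono (t := Set.Icc (-β) β ×ˢ Metric.closedBall 0 (Real.exp β))
    fun p hp => ?_) ((isCompact_Icc.prod (isCompact_closedBall _ _)).measure_lt_top)
  have := bounds_of_mem_wormFibre hp
  exact ⟨⟨(abs_lt.1 this.1).1.le, (abs_lt.1 this.1).2.le⟩, by simpa using this.2⟩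

theorem ae_mem_wormFibre (β : ℝ) : ∀ᵐ p ∂wormMeasure β, p ∈ wormFibre β :=
  ae_restrict_mem (measurableSet_wormFibre β)

theorem norm_zpow_sq {t : ℂ} (ht : t ≠ 0) (j : ℤ) :
    ‖t ^ j‖ ^ 2 = Real.exp (j * Real.log (‖t‖ ^ 2)) := by
  have h0 : 0 < ‖t‖ := norm_pos_iff.2 ht
  rw [norm_zpow, mul_comm, ← Real.rpow_def_of_pos (by positivity), Real.rpow_intCast,
    ← zpow_natCast, ← zpow_natCast, ← zpow_mul, ← zpow_mul, mul_comm]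

theorem norm_zpow_sq_le {β : ℝ} {p : ℝ × ℂ} (hp : p ∈ wormFibre β) (j : ℤ) :
    ‖p.2 ^ j‖ ^ 2 ≤ Real.exp (|(j : ℝ)| * β) := by
  rw [norm_zpow_sq hp.1]
  refine Real.exp_le_exp.2 ((le_abs_self _).trans ?_)
  rw [abs_mul]
  gcongr
  linarith [hp.2.2, Real.pi_pos]

theorem measurable_weight (j : ℤ) (ξ : ℝ) :
    Measurable fun p : ℝ × ℂ => Real.exp (-2 * p.1 * ξ) * ‖p.2 ^ j‖ ^ 2 := by
  simp_rw [norm_zpow]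
  have : Measurable fun p : ℝ × ℂ => ‖p.2‖ ^ j :=
    (by fun_prop : Measurable fun p : ℝ × ℂ => ‖p.2‖).pow_const j
  fun_prop

theorem integrable_weight (β : ℝ) (j : ℤ) (ξ : ℝ) :
    Integrable (fun p : ℝ × ℂ => Real.exp (-2 * p.1 * ξ) * ‖p.2 ^ j‖ ^ 2) (wormMeasure β) := by
  refine Integrable.of_bound (measurable_weight j ξ).aestronglyMeasurable
    (Real.exp (2 * β * |ξ|) * Real.exp (|(j : ℝ)| * β)) ?_
  filter_upwards [ae_mem_wormFibre β] with p hp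
  rw [Real.norm_of_nonneg (by positivity)]
  refine mul_le_mul (exp_mul_le_exp_mul_abs ?_ ξ) (norm_zpow_sq_le hp j) (by positivity)
    (Real.exp_nonneg _)
  rw [abs_mul]
  have := (bounds_of_mem_wormFibre hp).1
  norm_num
  exact this.le

theorem integral_exp_symm_interval {ξ : ℝ} (hξ : ξ ≠ 0) (s : ℝ) :
    ∫ y in Set.Ioo (s - Real.pi / 2) (s + Real.pi / 2), Real.exp (-2 * y * ξ) =
      Real.exp (-2 * s * ξ) * (Real.sinh (Real.pi * ξ) / ξ) := by
  have hpi := Real.pi_pos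
  rw [restrict_Ioo_eq_restrict_Ioc, ← intervalIntegral.integral_of_le (by linarith)]
  have hd : ∀ y ∈ Set.uIcc (s - Real.pi / 2) (s + Real.pi / 2),
      HasDerivAt (fun y : ℝ => Real.exp (-2 * y * ξ) / (-2 * ξ)) (Real.exp (-2 * y * ξ)) y := by
    intro y _
    have h1 : HasDerivAt (fun y : ℝ => -2 * y * ξ) (-2 * ξ) y := by
      simpa using ((hasDerivAt_id y).const_mul (-2)).mul_const ξ
    have h2 := h1.exp.div_const (-2 * ξ)
    rwa [mul_div_cancel_right₀ _ (by simpa using hξ)] at h2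
  rw [intervalIntegral.integral_eq_sub_of_hasDerivAt hd
    ((by fun_prop : Continuous fun y : ℝ => Real.exp (-2 * y * ξ)).intervalIntegrable _ _),
    Real.sinh_eq, show -2 * (s + Real.pi / 2) * ξ = -2 * s * ξ + -(Real.pi * ξ) by ring,
    show -2 * (s - Real.pi / 2) * ξ = -2 * s * ξ + Real.pi * ξ by ring, Real.exp_add, Real.exp_add]
  field_simp
  ring

/-- In polar coordinates the factor `r` raises the exponent so that the integrand is the derivative
of `e^{κ log r²} / (2κ)`. -/
theorem integral_annulus {c κ : ℝ} (hc : 0 < c) (hκ : κ ≠ 0) :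
    ∫ t : ℂ, {t : ℂ | t ≠ 0 ∧ |Real.log (‖t‖ ^ 2)| < c}.indicator
      (fun t => Real.exp ((κ - 1) * Real.log (‖t‖ ^ 2))) t =
      2 * Real.pi * (Real.sinh (c * κ) / κ) := by
  classical
  set S : Set ℝ := {r | r ≠ 0 ∧ |Real.log (r ^ 2)| < c}
  set h : ℝ → ℝ := fun r => Real.exp ((κ - 1) * Real.log (r ^ 2))
  have e1 : (fun t : ℂ => {t : ℂ | t ≠ 0 ∧ |Real.log (‖t‖ ^ 2)| < c}.indicator
      (fun t => Real.exp ((κ - 1) * Real.log (‖t‖ ^ 2))) t) = fun t : ℂ => S.indicator h ‖t‖ := by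
    funext t
    simp [Set.indicator, S, h]
  have hlogc : -c / 2 < c / 2 := by linarith
  have hSI : ∀ r ∈ Set.Ioi (0 : ℝ), r ∈ S ↔ r ∈ Set.Ioo (Real.exp (-c / 2)) (Real.exp (c / 2)) := by
    intro r hr
    have hr0 : 0 < r := hr
    simp only [S, Set.mem_ofPred_eq, Set.mem_Ioo, Real.log_pow, abs_lt, ne_eq, hr0.ne',
      not_false_eq_true, true_and, ← Real.lt_log_iff_exp_lt hr0, ← Real.log_lt_iff_lt_exp hr0]
    push_cast
    constructor <;> rintro ⟨_, _⟩ <;> constructor <;> linarith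
  have e2 : ∫ r in Set.Ioi (0 : ℝ), r ^ (Module.finrank ℝ ℂ - 1) • S.indicator h r =
      ∫ r in Set.Ioo (Real.exp (-c / 2)) (Real.exp (c / 2)), r * h r := by
    have hsub : Set.Ioo (Real.exp (-c / 2)) (Real.exp (c / 2)) ⊆ Set.Ioi 0 := fun r hr =>
      (Real.exp_pos _).trans hr.1
    rw [← Set.inter_eq_self_of_subset_left hsub, ← Measure.restrict_restrict measurableSet_Ioo,
      ← integral_indicator measurableSet_Ioo]
    · refine setIntegral_congr_fun measurableSet_Ioi fun r hr => ?_
      have := hSI r hr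
      by_cases hm : r ∈ S
      · simp [hm, this.1 hm, Complex.finrank_real_complex]
      · simp [hm, mt this.2 hm]
  have hd : ∀ r ∈ Set.uIcc (Real.exp (-c / 2)) (Real.exp (c / 2)),
      HasDerivAt (fun r : ℝ => Real.exp (κ * Real.log (r ^ 2)) / (2 * κ)) (r * h r) r := by
    intro r hr
    rw [Set.uIcc_of_le (Real.exp_le_exp.2 hlogc.le)] at hr
    have hr0 : 0 < r := (Real.exp_pos _).trans_le hr.1
    have h1 : HasDerivAt (fun r : ℝ => r ^ 2) (2 * r) r := by simpa using hasDerivAt_pow 2 r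
    have h2 := ((h1.log (by positivity)).const_mul κ).exp.div_const (2 * κ)
    refine h2.congr_deriv ?_
    change _ = r * Real.exp ((κ - 1) * Real.log (r ^ 2))
    rw [sub_mul, one_mul, Real.exp_sub, Real.exp_log (by positivity)]
    field_simp
  have hint : IntervalIntegrable (fun r => r * h r) volume (Real.exp (-c / 2))
      (Real.exp (c / 2)) := by
    refine ContinuousOn.intervalIntegrable fun r hr => ?_
    rw [Set.uIcc_of_le (Real.exp_le_exp.2 hlogc.le)] at hr
    have hr0 : 0 < r := (Real.exp_pos _).trans_le hr.1
    refine ContinuousAt.continuousWithinAt ?_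
    have : ContinuousAt (fun r : ℝ => Real.log (r ^ 2)) r :=
      (continuous_pow 2).continuousAt.log (by positivity)
    fun_prop
  have hball : (volume : Measure ℂ).real (Metric.ball 0 1) = Real.pi := by
    simp [Measure.real, Complex.volume_ball]
  rw [e1, integral_fun_norm_addHaar volume, e2, hball, Complex.finrank_real_complex,
    restrict_Ioo_eq_restrict_Ioc,
    ← intervalIntegral.integral_of_le (Real.exp_le_exp.2 hlogc.le),
    intervalIntegral.integral_eq_sub_of_hasDerivAt hd hint]
  simp only [Real.log_pow, Real.log_exp, Real.sinh_eq, nsmul_eq_mul, smul_eq_mul]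
  push_cast
  rw [show κ * (2 * (c / 2)) = c * κ by ring, show κ * (2 * (-c / 2)) = -(c * κ) by ring]
  field_simp

/-- For fixed `z₂`, the height runs over an interval of length `π` centred at `log |z₂|²`, which
yields `sinh (πξ) / ξ` and shifts the exponent `j` to `j - 2ξ = κ - 1`; the annulus integral does
the rest. At the two excluded frequencies `multiplier` is `0`, by division by zero. -/
theorem integral_weight {β : ℝ} (hβ : Real.pi / 2 < β) (j : ℤ) {ξ : ℝ} (h0 : ξ ≠ 0)
    (ha : ξ ≠ ((j : ℝ) + 1) / 2) :
    multiplier β j ξ * ∫ p, Real.exp (-2 * p.1 * ξ) * ‖p.2 ^ j‖ ^ 2 ∂wormMeasure β =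
      Real.pi := by
  classical
  have hpi := Real.pi_pos
  set κ : ℝ := j + 1 - 2 * ξ with hκdef
  have hκ : κ ≠ 0 := fun h => ha (by linarith)
  set c := β - Real.pi / 2 with hcdef
  have hc : 0 < c := by linarith
  have hint := integrable_weight β j ξ
  set g : ℝ × ℂ → ℝ := fun p => Real.exp (-2 * p.1 * ξ) * ‖p.2 ^ j‖ ^ 2 with hg
  have hint' : Integrable ((wormFibre β).indicator g)
      ((volume : Measure ℝ).prod (volume : Measure ℂ)) := by
    rw [integrable_indicator_iff (measurableSet_wormFibre β)]; exact hint
  have hfib : ∀ t : ℂ, ∫ y : ℝ, (wormFibre β).indicator g (y, t) =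
      (Real.sinh (Real.pi * ξ) / ξ) * {t : ℂ | t ≠ 0 ∧ |Real.log (‖t‖ ^ 2)| < c}.indicator
      (fun t => Real.exp ((κ - 1) * Real.log (‖t‖ ^ 2))) t := by
    intro t
    by_cases ht : t ∈ {t : ℂ | t ≠ 0 ∧ |Real.log (‖t‖ ^ 2)| < c}
    · rw [Set.indicator_of_mem ht]
      set s := Real.log (‖t‖ ^ 2) with hs
      have : (fun y : ℝ => (wormFibre β).indicator g (y, t)) =
          (Set.Ioo (s - Real.pi / 2) (s + Real.pi / 2)).indicator
            (fun y => Real.exp (-2 * y * ξ) * ‖t ^ j‖ ^ 2) := by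
        funext y
        have : (y, t) ∈ wormFibre β ↔ y ∈ Set.Ioo (s - Real.pi / 2) (s + Real.pi / 2) := by
          simp only [wormFibre, Set.mem_ofPred_eq, Set.mem_Ioo, ← hs, abs_lt (b := Real.pi / 2)]
          constructor
          · rintro ⟨_, ⟨_, _⟩, _⟩; constructor <;> linarith
          · rintro ⟨_, _⟩; exact ⟨ht.1, ⟨by linarith, by linarith⟩, ht.2⟩
        simp only [Set.indicator, this, hg]
      rw [this, integral_indicator measurableSet_Ioo, integral_mul_const,
        integral_exp_symm_interval h0, norm_zpow_sq ht.1, ← hs]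
      have e : Real.exp ((κ - 1) * s) = Real.exp (-2 * s * ξ) * Real.exp (j * s) := by
        rw [← Real.exp_add]; congr 1; rw [hκdef]; ring
      rw [e]; ring
    · rw [Set.indicator_of_notMem ht, mul_zero]
      have : ∀ y : ℝ, (wormFibre β).indicator g (y, t) = 0 := fun y =>
        Set.indicator_of_notMem (fun h => ht ⟨h.1, h.2.2⟩) _
      simp [this]
  have hval : ∫ p, g p ∂wormMeasure β =
      (Real.sinh (Real.pi * ξ) / ξ) * (2 * Real.pi * (Real.sinh (c * κ) / κ)) := by
    rw [wormMeasure, ← integral_indicator (measurableSet_wormFibre β), Measure.volume_eq_prod,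
      integral_prod_symm _ hint']
    simp_rw [hfib]
    rw [integral_const_mul, integral_annulus hc hκ]
  rw [hval, multiplier]
  set a : ℝ := ((j : ℝ) + 1) / 2 with hadef
  have hκa : κ = -2 * (ξ - a) := by rw [hκdef, hadef]; ring
  have hca : c * κ = -((2 * β - Real.pi) * (ξ - a)) := by rw [hκa, hcdef]; ring
  have hξa : ξ - a ≠ 0 := sub_ne_zero.2 ha
  have hs1 : Real.sinh (Real.pi * ξ) ≠ 0 := by
    rw [Ne, Real.sinh_eq_zero]; exact mul_ne_zero hpi.ne' h0
  have hs2 : Real.sinh ((2 * β - Real.pi) * (ξ - a)) ≠ 0 := by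
    rw [Ne, Real.sinh_eq_zero]; exact mul_ne_zero (by linarith) hξa
  rw [hca, Real.sinh_neg, hκa]
  generalize Real.sinh ((2 * β - Real.pi) * (ξ - a)) = u at *
  field_simp

end

/-! ### Reproducing formula in the strip under Gaussian decay. -/

section

open scoped ENNReal Topology ComplexConjugate
open Filter

theorem HasGaussianDecay.mul_of_norm_le {β ε K : ℝ} {G k : ℂ → ℂ} (hG : HasGaussianDecay β ε G)
    (hk : ∀ z : ℂ, |z.im| < β → ‖k z‖ ≤ K) : HasGaussianDecay β ε fun z => G z * k z := by
  intro y hy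
  obtain ⟨δ, hδ, C, hC⟩ := hG y hy
  refine ⟨δ, hδ, C * K, fun z hz hz' => ?_⟩
  rw [norm_mul, mul_right_comm]
  exact mul_le_mul (hC z hz hz') (hk z hz') (norm_nonneg _) ((norm_nonneg _).trans (hC z hz hz'))

/-- Decay of rate `0` is local boundedness in the height, and `|e^{-εz²}| = e^{-εx² + εy²}` with `y`
bounded. -/
theorem HasGaussianDecay.of_locally_bounded {β ε : ℝ} (hε : 0 < ε) {F : ℂ → ℂ}
    (hF : HasGaussianDecay β 0 F) :
    HasGaussianDecay β ε fun z => F z * Complex.exp (-ε * z ^ 2) := by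
  intro y hy
  obtain ⟨δ, hδ, C, hC⟩ := hF y hy
  refine ⟨δ, hδ, C * Real.exp (ε * β ^ 2), fun z hz hz' => ?_⟩
  have h1 := hC z hz hz'
  simp only [neg_zero, zero_mul, Real.exp_zero, mul_one] at h1
  rw [norm_mul, mul_assoc, ← Real.exp_add]
  refine mul_le_mul h1 ?_ (norm_nonneg _) ((norm_nonneg _).trans h1)
  rw [Complex.norm_exp]
  refine Real.exp_le_exp.2 ?_
  have h2 : z.im ^ 2 ≤ β ^ 2 := sq_le_sq' (abs_lt.1 hz').1.le (abs_lt.1 hz').2.le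
  have h3 : (-(ε : ℂ) * z ^ 2).re = -ε * z.re ^ 2 + ε * z.im ^ 2 := by
    simp [sq]; ring
  rw [h3]
  nlinarith

/-- The Fourier transform on the real axis. -/
noncomputable def axisFourier (G : ℂ → ℂ) (ξ : ℝ) : ℂ :=
  ∫ x : ℝ, G x * Complex.exp (-(Complex.I * x * ξ))

section axisFourier

variable {β ε : ℝ} {G : ℂ → ℂ}

/-- For fixed `ξ` the factor `e^{-izξ}` is bounded on the strip, so the contour can be shifted to
the real axis. -/
theorem integral_line_eq_axisFourier (hε : 0 < ε) (hdec : HasGaussianDecay β ε G)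
    (hG : DifferentiableOn ℂ G {z | |z.im| < β}) {y : ℝ} (hy : |y| < β) (ξ : ℝ) :
    ∫ x : ℝ, G (x + y * Complex.I) * Complex.exp (-(Complex.I * x * ξ)) =
      Complex.exp (-(y * ξ)) * axisFourier G ξ := by
  have h0 : |(0 : ℝ)| < β := by simpa using (abs_nonneg y).trans_lt hy
  have hk : HasGaussianDecay β ε fun z => G z * Complex.exp (-(Complex.I * z * ξ)) := by
    refine hdec.mul_of_norm_le (K := Real.exp (β * |ξ|)) fun z hz => ?_
    rw [Complex.norm_exp]
    have : (-(Complex.I * z * ξ)).re = z.im * ξ := by simp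
    rw [this]
    exact exp_mul_le_exp_mul_abs hz.le ξ
  have := hk.integral_eq hε (hG.mul (by fun_prop)) hy h0
  simp only [Complex.ofReal_zero, zero_mul, add_zero] at this
  rw [axisFourier, ← this, ← integral_const_mul]
  congr 1 with x
  rw [mul_left_comm, ← Complex.exp_add]
  congr 2
  linear_combination (y * ξ : ℂ) * Complex.I_sq

theorem continuous_axisFourier (hε : 0 < ε) (hdec : HasGaussianDecay β ε G)
    (hG : ContinuousOn G {z | |z.im| < β}) (hβ : 0 < β) : Continuous (axisFourier G) := by
  have h0 : |(0 : ℝ)| < β := by simpa using hβ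
  have hc := continuous_horizontal hG h0
  have hi := hdec.integrable hε hG h0
  simp only [Complex.ofReal_zero, zero_mul, add_zero] at hc hi
  refine continuous_of_dominated (bound := fun x : ℝ => ‖G x‖)
    (fun ξ => (hc.mul (by fun_prop)).aestronglyMeasurable)
    (fun ξ => Eventually.of_forall fun x => ?_) hi.norm
    (Eventually.of_forall fun x => by fun_prop)
  rw [norm_mul, Complex.norm_exp]
  simp

theorem exists_norm_axisFourier_le (hε : 0 < ε) (hdec : HasGaussianDecay β ε G)
    (hG : DifferentiableOn ℂ G {z | |z.im| < β}) {y : ℝ} (hy : |y| < β) :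
    ∃ C, 0 ≤ C ∧ ∀ ξ : ℝ, ‖axisFourier G ξ‖ ≤ C * Real.exp (y * ξ) := by
  refine ⟨∫ x : ℝ, ‖G (x + y * Complex.I)‖, integral_nonneg fun x => norm_nonneg _, fun ξ => ?_⟩
  have h := integral_line_eq_axisFourier hε hdec hG hy ξ
  have h1 : axisFourier G ξ = Complex.exp (y * ξ) *
      ∫ x : ℝ, G (x + y * Complex.I) * Complex.exp (-(Complex.I * x * ξ)) := by
    rw [h, ← mul_assoc, ← Complex.exp_add]
    simp
  have h2 : ‖Complex.exp (y * ξ)‖ = Real.exp (y * ξ) := by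
    rw [Complex.norm_exp]; simp
  rw [h1, norm_mul, h2, mul_comm]
  refine mul_le_mul_of_nonneg_right ((norm_integral_le_integral_norm _).trans (le_of_eq ?_))
    (Real.exp_nonneg _)
  congr 1 with x
  rw [norm_mul, Complex.norm_exp]
  simp

theorem integrable_exp_mul_axisFourier (hε : 0 < ε) (hdec : HasGaussianDecay β ε G)
    (hG : DifferentiableOn ℂ G {z | |z.im| < β}) {w : ℂ} (hw : |w.im| < β) :
    Integrable fun ξ : ℝ => Complex.exp (Complex.I * w * ξ) * axisFourier G ξ := by
  have hβ : 0 < β := (abs_nonneg _).trans_lt hw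
  -- Both heights `Im w ± τ` stay in the strip; the lower one gives decay for `ξ ≥ 0`, the upper one
  -- for `ξ ≤ 0`.
  obtain ⟨τ, hτ0, hτ⟩ := exists_between (sub_pos.2 hw)
  have hw' := abs_lt.1 hw
  have hle := abs_le.1 (le_refl |w.im|)
  obtain ⟨C₁, h10, h1⟩ := exists_norm_axisFourier_le hε hdec hG (y := w.im - τ)
    (abs_lt.2 ⟨by linarith, by linarith⟩)
  obtain ⟨C₂, h20, h2⟩ := exists_norm_axisFourier_le hε hdec hG (y := w.im + τ)
    (abs_lt.2 ⟨by linarith, by linarith⟩)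
  have hcont := continuous_axisFourier hε hdec hG.continuousOn hβ
  refine ((integrable_exp_neg_mul_abs hτ0).const_mul (C₁ + C₂)).mono'
    (Continuous.aestronglyMeasurable (by fun_prop)) (Eventually.of_forall fun ξ => ?_)
  have h3 : (Complex.I * w * ξ).re = -w.im * ξ := by simp
  rw [norm_mul, Complex.norm_exp, h3]
  rcases le_total 0 ξ with hξ | hξ
  · rw [abs_of_nonneg hξ]
    calc _ ≤ Real.exp (-w.im * ξ) * (C₁ * Real.exp ((w.im - τ) * ξ)) := by gcongr; exact h1 ξ
      _ = C₁ * Real.exp (-τ * ξ) := by rw [mul_left_comm, ← Real.exp_add]; congr 2; ring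
      _ ≤ _ := by gcongr; linarith
  · rw [abs_of_nonpos hξ]
    calc _ ≤ Real.exp (-w.im * ξ) * (C₂ * Real.exp ((w.im + τ) * ξ)) := by gcongr; exact h2 ξ
      _ = C₂ * Real.exp (-τ * -ξ) := by rw [mul_left_comm, ← Real.exp_add]; congr 2; ring
      _ ≤ _ := by gcongr; linarith

/-- Fourier inversion at `Re w` on the line through `w`, whose transform is `e^{-ξ Im w}` times the
one on the axis. -/
theorem integral_exp_mul_axisFourier (hε : 0 < ε) (hdec : HasGaussianDecay β ε G)
    (hG : DifferentiableOn ℂ G {z | |z.im| < β}) {w : ℂ} (hw : |w.im| < β) :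
    ∫ ξ : ℝ, Complex.exp (Complex.I * w * ξ) * axisFourier G ξ = 2 * Real.pi * G w := by
  have hline := fun ξ => integral_line_eq_axisFourier hε hdec hG hw ξ
  have hint := integrable_exp_mul_axisFourier hε hdec hG (w := w.im * Complex.I) (by simpa using hw)
  have hexp : ∀ ξ : ℝ, Complex.exp (Complex.I * (w.im * Complex.I) * ξ) =
      Complex.exp (-(w.im * ξ)) := fun ξ => by
    congr 1; linear_combination (w.im * ξ : ℂ) * Complex.I_sq
  simp_rw [hexp, ← hline] at hint
  have := integral_cexp_mul_integral_cexp_neg (continuous_horizontal hG.continuousOn hw)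
    (hdec.integrable hε hG.continuousOn hw) hint w.re
  rw [Complex.re_add_im] at this
  rw [← this]
  congr 1 with ξ
  rw [hline, ← mul_assoc, ← Complex.exp_add]
  congr 2
  linear_combination (-(Complex.I * ξ)) * (Complex.re_add_im w) + (w.im * ξ : ℂ) * Complex.I_sq

end axisFourier

theorem conj_kernelFactor (β : ℝ) (j : ℤ) (x y : ℝ) (w : ℂ) :
    conj (kernelFactor β j (x + y * Complex.I) w) = 1 / (2 * (Real.pi : ℂ) ^ 2) *
      ∫ ξ : ℝ, Complex.exp (-(Complex.I * x * ξ)) *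
        (Complex.exp (Complex.I * (w + y * Complex.I) * ξ) * multiplier β j ξ) := by
  rw [kernelFactor, map_mul, ← integral_conj]
  congr 1
  · simp [Complex.conj_ofNat]
  · congr 1 with ξ
    rw [kernelIntegrand_eq, map_mul, ← Complex.exp_conj, Complex.conj_ofReal, ← mul_assoc,
      ← Complex.exp_add]
    congr 2
    simp
    ring

/-- The inner product with the kernel factor over one horizontal line. -/
theorem integral_line_mul_conj_kernelFactor {β ε : ℝ} (hβ : Real.pi / 2 < β) (j : ℤ) {G : ℂ → ℂ}
    (hε : 0 < ε) (hdec : HasGaussianDecay β ε G) (hG : DifferentiableOn ℂ G {z | |z.im| < β})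
    {w : ℂ} (hw : |w.im| < β) {y : ℝ} (hy : |y| < β) :
    ∫ x : ℝ, G (x + y * Complex.I) * conj (kernelFactor β j (x + y * Complex.I) w) =
      1 / (2 * (Real.pi : ℂ) ^ 2) * ∫ ξ : ℝ, (Real.exp (-2 * y * ξ) * multiplier β j ξ : ℝ) *
        (Complex.exp (Complex.I * w * ξ) * axisFourier G ξ) := by
  set q : ℝ → ℂ := fun ξ => Complex.exp (Complex.I * (w + y * Complex.I) * ξ) * multiplier β j ξ
  have hqm : Measurable q := (by fun_prop : Measurable fun ξ : ℝ =>
    Complex.exp (Complex.I * (w + y * Complex.I) * ξ)).mul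
      (Complex.measurable_ofReal.comp (measurable_multiplier β j))
  have hq : Integrable q := by
    rw [← integrable_norm_iff hqm.aestronglyMeasurable]
    have := integrable_exp_mul_multiplier hβ j (t := -(w.im + y))
      (by rw [abs_neg]; exact (abs_add_le _ _).trans_lt (by linarith))
    refine this.congr (Eventually.of_forall fun ξ => ?_)
    simp only [q]
    rw [norm_mul, Complex.norm_exp, Complex.norm_real,
      Real.norm_of_nonneg (multiplier_nonneg hβ j ξ)]
    congr 2
    simp
  have hGi := hdec.integrable hε hG.continuousOn hy
  have hGc := continuous_horizontal hG.continuousOn hy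
  have hprod : Integrable (Function.uncurry fun x ξ : ℝ =>
      G (x + y * Complex.I) * Complex.exp (-(Complex.I * x * ξ)) * q ξ)
      ((volume : Measure ℝ).prod volume) := by
    refine (hGi.mul_prod hq).mono ?_ (Eventually.of_forall fun p => ?_)
    · refine AEStronglyMeasurable.mul (Continuous.aestronglyMeasurable ?_)
        (hqm.comp measurable_snd).aestronglyMeasurable
      exact (hGc.comp continuous_fst).mul (by fun_prop)
    · simp [Function.uncurry, Complex.norm_exp]
  calc ∫ x : ℝ, G (x + y * Complex.I) * conj (kernelFactor β j (x + y * Complex.I) w)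
      = 1 / (2 * (Real.pi : ℂ) ^ 2) * ∫ x : ℝ, ∫ ξ : ℝ,
          G (x + y * Complex.I) * Complex.exp (-(Complex.I * x * ξ)) * q ξ := by
        rw [← integral_const_mul]
        congr 1 with x
        rw [conj_kernelFactor, mul_left_comm, ← integral_const_mul]
        simp_rw [q, mul_assoc]
    _ = 1 / (2 * (Real.pi : ℂ) ^ 2) * ∫ ξ : ℝ, (Real.exp (-2 * y * ξ) * multiplier β j ξ : ℝ) *
        (Complex.exp (Complex.I * w * ξ) * axisFourier G ξ) := by
        rw [integral_integral_swap hprod]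
        congr 2 with ξ
        rw [integral_mul_const, integral_line_eq_axisFourier hε hdec hG hy]
        have e : Complex.exp (-(y * ξ)) * Complex.exp (Complex.I * (w + y * Complex.I) * ξ) =
            Complex.exp (-2 * y * ξ) * Complex.exp (Complex.I * w * ξ) := by
          rw [← Complex.exp_add, ← Complex.exp_add]
          congr 1
          linear_combination (y * ξ : ℂ) * Complex.I_sq
        simp only [q]
        push_cast
        linear_combination (axisFourier G ξ * multiplier β j ξ) * e

theorem ae_integral_weight {β : ℝ} (hβ : Real.pi / 2 < β) (j : ℤ) :
    ∀ᵐ ξ : ℝ, multiplier β j ξ *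
      ∫ p, Real.exp (-2 * p.1 * ξ) * ‖p.2 ^ j‖ ^ 2 ∂wormMeasure β = Real.pi := by
  filter_upwards [compl_mem_ae_iff.2 (measure_singleton (0 : ℝ)),
    compl_mem_ae_iff.2 (measure_singleton (((j : ℝ) + 1) / 2))] with ξ h0 ha
  exact integral_weight hβ j h0 ha

/-- The reproducing formula for functions with Gaussian decay. -/
theorem integral_wormMeasure_mul_conj_kernelFactor {β ε : ℝ} (hβ : Real.pi / 2 < β) (j : ℤ)
    {G : ℂ → ℂ} (hε : 0 < ε) (hdec : HasGaussianDecay β ε G)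
    (hG : DifferentiableOn ℂ G {z | |z.im| < β}) {w : ℂ} (hw : |w.im| < β) :
    ∫ p, (‖p.2 ^ j‖ ^ 2 : ℝ) * (∫ x : ℝ, G (x + p.1 * Complex.I) *
      conj (kernelFactor β j (x + p.1 * Complex.I) w)) ∂wormMeasure β = G w := by
  have hpi := Real.pi_pos
  have hβ0 : 0 < β := by linarith
  set E : ℝ → ℂ := fun ξ => Complex.exp (Complex.I * w * ξ) * axisFourier G ξ
  have hE : Integrable E := integrable_exp_mul_axisFourier hε hdec hG hw
  have hAc := continuous_axisFourier hε hdec hG.continuousOn hβ0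
  have hEm : Measurable E := (by fun_prop : Continuous E).measurable
  set W : ℝ × ℂ → ℝ → ℝ := fun p ξ => Real.exp (-2 * p.1 * ξ) * ‖p.2 ^ j‖ ^ 2
  have hW0 : ∀ p ξ, 0 ≤ W p ξ := fun p ξ => by positivity
  have hWm : Measurable (Function.uncurry W) := by
    have : Measurable fun p : (ℝ × ℂ) × ℝ => ‖p.1.2‖ ^ j :=
      (by fun_prop : Measurable fun p : (ℝ × ℂ) × ℝ => ‖p.1.2‖).pow_const j
    simp only [W, norm_zpow, Function.uncurry_def]
    fun_prop
  -- Since `W` and the multiplier are nonnegative, integrating the norm over the fibre gives exactly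
  -- `π ‖E ξ‖` for almost every `ξ`.
  have hprod : Integrable (Function.uncurry fun (p : ℝ × ℂ) (ξ : ℝ) =>
      ((W p ξ * multiplier β j ξ : ℝ) : ℂ) * E ξ) ((wormMeasure β).prod volume) := by
    have hm : Measurable (Function.uncurry fun (p : ℝ × ℂ) (ξ : ℝ) =>
        ((W p ξ * multiplier β j ξ : ℝ) : ℂ) * E ξ) :=
      (Complex.measurable_ofReal.comp
        (hWm.mul ((measurable_multiplier β j).comp measurable_snd))).mul (hEm.comp measurable_snd)
    rw [integrable_prod_iff' hm.aestronglyMeasurable]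
    constructor
    · refine Eventually.of_forall fun ξ => ?_
      exact ((((integrable_weight β j ξ).mul_const (multiplier β j ξ)).ofReal (𝕜 := ℂ))).mul_const
        (E ξ)
    · refine (hE.norm.const_mul Real.pi).congr ?_
      filter_upwards [ae_integral_weight hβ j] with ξ hξ
      simp only [Function.uncurry_apply_pair, norm_mul, Complex.norm_real]
      rw [integral_mul_const, ← hξ, integral_mul_const]
      simp only [Real.norm_of_nonneg (hW0 _ ξ), Real.norm_of_nonneg (multiplier_nonneg hβ j ξ)]
      ring
  calc ∫ p, (‖p.2 ^ j‖ ^ 2 : ℝ) * (∫ x : ℝ, G (x + p.1 * Complex.I) *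
        conj (kernelFactor β j (x + p.1 * Complex.I) w)) ∂wormMeasure β
      = ∫ p, 1 / (2 * (Real.pi : ℂ) ^ 2) *
          (∫ ξ, ((W p ξ * multiplier β j ξ : ℝ) : ℂ) * E ξ) ∂wormMeasure β := by
        refine integral_congr_ae ?_
        filter_upwards [ae_mem_wormFibre β] with p hp
        rw [integral_line_mul_conj_kernelFactor hβ j hε hdec hG hw
          (bounds_of_mem_wormFibre hp).1, mul_left_comm, ← integral_const_mul]
        congr 2 with ξ
        simp only [W, E]
        push_cast
        ring
    _ = 1 / (2 * (Real.pi : ℂ) ^ 2) * ∫ ξ, Real.pi * E ξ := by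
        rw [integral_const_mul, integral_integral_swap hprod]
        congr 1
        refine integral_congr_ae ?_
        filter_upwards [ae_integral_weight hβ j] with ξ hξ
        rw [integral_mul_const, integral_complex_ofReal, integral_mul_const, ← hξ,
          mul_comm (multiplier β j ξ)]
    _ = G w := by
        rw [integral_const_mul, integral_exp_mul_axisFourier hε hdec hG hw]
        field_simp

end

/-! ### Membership, reproduction and uniqueness of the kernel. -/

section

open scoped ENNReal Topology ComplexConjugate
open Filter

/-- The kernel `H_j(z₁, w₁) z₂ʲ w̄₂ʲ`. -/
noncomputable def wormKernel (β : ℝ) (j : ℤ) (z w : ℂ × ℂ) : ℂ :=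
  kernelFactor β j z.1 w.1 * z.2 ^ j * conj w.2 ^ j

theorem rotate_mem_wormDomain {β : ℝ} {z : ℂ × ℂ} (hz : z ∈ wormDomain β) (θ : ℝ) :
    (z.1, Complex.exp (Complex.I * θ) * z.2) ∈ wormDomain β := by
  have : ‖Complex.exp (Complex.I * θ)‖ = 1 := by rw [mul_comm]; exact Complex.norm_exp_ofReal_mul_I θ
  refine ⟨mul_ne_zero (Complex.exp_ne_zero _) hz.1, ?_, ?_⟩
  · simpa [this] using hz.2.1
  · simpa [this] using hz.2.2

theorem rotationalComponent_congr {β : ℝ} {j : ℤ} {f g : ℂ × ℂ → ℂ}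
    (hf : f ∈ rotationalComponent (wormDomain β) j) (hfg : Set.EqOn f g (wormDomain β)) :
    g ∈ rotationalComponent (wormDomain β) j := by
  refine ⟨⟨hf.1.1.congr fun z hz => (hfg hz).symm, hf.1.2.ae_eq ?_⟩, fun z hz θ => ?_⟩
  · filter_upwards [ae_restrict_mem (isOpen_wormDomain β).measurableSet] with z hz using hfg hz
  · rw [← hfg hz, ← hfg (rotate_mem_wormDomain hz θ)]
    exact hf.2 z hz θ

theorem lintegral_wormDomain {β : ℝ} {g : ℂ × ℂ → ℝ≥0∞}
    (hg : AEMeasurable g (volume.restrict (wormDomain β))) :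
    ∫⁻ z in wormDomain β, g z =
      ∫⁻ p, ∫⁻ x : ℝ, g ((x : ℂ) + (p.1 : ℂ) * Complex.I, p.2) ∂volume ∂wormMeasure β := by
  have hmp := measurePreserving_wormChart_restrict β
  rw [← hmp.lintegral_comp_emb wormChart.measurableEmbedding, lintegral_prod_symm]
  · simp_rw [wormChart_apply]
  · exact hg.comp_quasiMeasurePreserving hmp.quasiMeasurePreserving

theorem integral_wormDomain {β : ℝ} {g : ℂ × ℂ → ℂ} (hg : IntegrableOn g (wormDomain β)) :
    ∫ z in wormDomain β, g z =
      ∫ p, (∫ x : ℝ, g ((x : ℂ) + (p.1 : ℂ) * Complex.I, p.2)) ∂wormMeasure β := by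
  have hmp := measurePreserving_wormChart_restrict β
  rw [← hmp.integral_comp wormChart.measurableEmbedding, integral_prod_symm]
  · simp_rw [wormChart_apply]
  · exact (hmp.integrable_comp_emb wormChart.measurableEmbedding).2 hg

theorem differentiableOn_wormKernel {β : ℝ} (hβ : Real.pi / 2 < β) (j : ℤ) {w : ℂ × ℂ}
    (hw : w ∈ wormDomain β) : DifferentiableOn ℂ (fun z => wormKernel β j z w) (wormDomain β) := by
  refine DifferentiableOn.mul_const (DifferentiableOn.mul ?_ ?_) _
  · refine (differentiableOn_kernelFactor hβ j w.1).comp (by fun_prop) fun z hz => ?_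
    have h1 := abs_im_lt_of_mem_wormDomain hz
    have h2 := abs_im_lt_of_mem_wormDomain hw
    exact show |z.1.im + w.1.im| < 2 * β from (abs_add_le _ _).trans_lt (by linarith)
  · exact differentiableOn_snd.zpow (Or.inl fun z hz => hz.1)

theorem memLp_two_of_lintegral_lt_top {α : Type*} [MeasurableSpace α] {μ : Measure α} {f : α → ℂ}
    (hf : AEStronglyMeasurable f μ) (h : ∫⁻ a, ‖f a‖ₑ ^ 2 ∂μ < ∞) : MemLp f 2 μ := by
  refine ⟨hf, ?_⟩
  rw [eLpNorm_lt_top_iff_lintegral_rpow_enorm_lt_top two_ne_zero ENNReal.ofNat_ne_top]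
  simpa using h

/-- On a horizontal line the `L²` bound for `H_j` is uniform in the height; `|z₂ʲ|` is bounded and
the fibre measure is finite. -/
theorem wormKernel_mem {β : ℝ} (hβ : Real.pi / 2 < β) (j : ℤ) {w : ℂ × ℂ}
    (hw : w ∈ wormDomain β) :
    (fun z => wormKernel β j z w) ∈ rotationalComponent (wormDomain β) j := by
  have hdiff := differentiableOn_wormKernel hβ j hw
  have hmeas : AEStronglyMeasurable (fun z => wormKernel β j z w)
      (volume.restrict (wormDomain β)) :=
    hdiff.continuousOn.aestronglyMeasurable (isOpen_wormDomain β).measurableSet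
  refine ⟨⟨hdiff, memLp_two_of_lintegral_lt_top hmeas ?_⟩, fun z hz θ => ?_⟩
  · obtain ⟨M, hM, hMle⟩ := exists_lintegral_enorm_kernelFactor_sq_le hβ j
      (abs_im_lt_of_mem_wormDomain hw)
    rw [lintegral_wormDomain (hmeas.enorm.pow_const 2)]
    set N : ℝ≥0∞ := ENNReal.ofReal (Real.exp (|(j : ℝ)| * β)) * ‖conj w.2 ^ j‖ₑ ^ 2
    have hN : N ≠ ∞ := ENNReal.mul_ne_top ENNReal.ofReal_ne_top (ENNReal.pow_ne_top enorm_ne_top)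
    calc _ ≤ ∫⁻ _, M * N ∂wormMeasure β := by
          refine lintegral_mono_ae ?_
          filter_upwards [ae_mem_wormFibre β] with p hp
          have hp2 : ‖p.2 ^ j‖ₑ ^ 2 ≤ ENNReal.ofReal (Real.exp (|(j : ℝ)| * β)) := by
            rw [← ofReal_norm, ← ENNReal.ofReal_pow (norm_nonneg _)]
            exact ENNReal.ofReal_le_ofReal (norm_zpow_sq_le hp j)
          simp only [wormKernel, enorm_mul, mul_pow, mul_assoc]
          rw [lintegral_mul_const' _ _ (ENNReal.mul_ne_top (ENNReal.pow_ne_top enorm_ne_top)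
            (ENNReal.pow_ne_top enorm_ne_top))]
          exact mul_le_mul' (hMle p.1 (bounds_of_mem_wormFibre hp).1)
            (mul_le_mul_left hp2 _)
      _ < ∞ := by
          rw [lintegral_const]
          exact ENNReal.mul_lt_top (ENNReal.mul_lt_top hM.lt_top hN.lt_top) (measure_lt_top _ _)
  · simp only [wormKernel]
    rw [mul_zpow, ← Complex.exp_int_mul, show (j : ℂ) * (Complex.I * θ) = Complex.I * j * θ by ring]
    ring

/-- Functions in the rotational component are bounded on thin horizontal slabs. -/
theorem wormFactor_locally_bounded {β : ℝ} (hβ : Real.pi / 2 < β) {j : ℤ} {f : ℂ × ℂ → ℂ}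
    (hf : f ∈ rotationalComponent (wormDomain β) j) :
    HasGaussianDecay β 0 (wormFactor β j f) := by
  intro y₀ hy₀
  have hpi := Real.pi_pos
  set b : ℂ := ((wormSection β y₀ : ℝ) : ℂ)
  have hmem : ((y₀ : ℂ) * Complex.I, b) ∈ wormDomain β := by
    have := wormSection_mem hβ (z := (y₀ : ℂ) * Complex.I) (by simpa using hy₀)
    simpa [b] using this
  have hopen : IsOpen {p : ℝ × ℂ | ((p.1 : ℂ) * Complex.I, p.2) ∈ wormDomain β} :=
    (isOpen_wormDomain β).preimage (by fun_prop)
  obtain ⟨U, V, hU, hV, hyU, hbV, hUV⟩ := isOpen_prod_iff.1 hopen y₀ b hmem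
  obtain ⟨r, hr, hrU⟩ := Metric.isOpen_iff.1 hU y₀ hyU
  have hdom : ∀ z : ℂ, |z.im - y₀| < r → ∀ t ∈ V, (z, t) ∈ wormDomain β := by
    intro z hz t ht
    have : (z.im, t) ∈ U ×ˢ V := ⟨hrU (by simpa [Real.dist_eq] using hz), ht⟩
    simpa [wormDomain] using hUV this
  set g : ℂ × ℂ → ℝ≥0∞ := (wormDomain β).indicator fun z => ‖f z‖ₑ ^ 2
  have hDm := (isOpen_wormDomain β).measurableSet
  -- Only almost every slice `z₂ = t` has finite norm, but one such `t` in `V` suffices: `F` can be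
  -- read off from any point of the fibre.
  have hg : ∀ᵐ t : ℂ, ∫⁻ z : ℂ, g (z, t) < ∞ := by
    have h1 : ∫⁻ z, g z < ∞ := by
      rw [lintegral_indicator hDm]
      have := (eLpNorm_lt_top_iff_lintegral_rpow_enorm_lt_top two_ne_zero
        ENNReal.ofNat_ne_top).1 hf.1.2.2
      simpa using this
    have hgm : AEMeasurable g ((volume : Measure ℂ).prod volume) := by
      rw [← Measure.volume_eq_prod]
      exact (aemeasurable_indicator_iff hDm).2 (hf.1.2.1.enorm.pow_const 2)
    rw [Measure.volume_eq_prod, lintegral_prod_symm _ hgm] at h1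
    exact ae_lt_top' hgm.lintegral_prod_left' h1.ne
  obtain ⟨t, htV, ht⟩ := (Measure.dense_of_ae hg).inter_open_nonempty V hV ⟨b, hbV⟩
  set M : ℝ≥0∞ := ∫⁻ z : ℂ, g (z, t)
  have hM : M ≠ ∞ := ht.ne
  -- Discs of radius `R` centred within `R` of height `y₀` stay in the slab of half-width `r`.
  set R : ℝ := r / 2
  have hR : 0 < R := by positivity
  refine ⟨R, hR, √(M.toReal / (Real.pi * R ^ 2)) * ‖t ^ (-j)‖, fun z hz hz' => ?_⟩
  have hball : ∀ u ∈ Metric.ball z R, (u, t) ∈ wormDomain β := by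
    intro u hu
    refine hdom u ?_ t htV
    have h1 : |u.im - z.im| < R := by
      rw [← Complex.sub_im]
      exact (Complex.abs_im_le_norm _).trans_lt (by simpa [dist_eq_norm] using hu)
    have h2 := abs_sub_le u.im z.im y₀
    have h3 : R = r / 2 := rfl
    linarith
  have hzt := hball z (Metric.mem_ball_self hR)
  -- Applied to the square of `f`, so that the slice's `L²` norm appears directly.
  have hmean := enorm_mul_le_lintegral_ball (F := fun u => f (u, t) ^ 2) hR
    ((hf.1.1.comp (by fun_prop : DifferentiableOn ℂ (fun u : ℂ => (u, t)) _) hball).pow 2)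
  have hle : ∫⁻ u in Metric.ball z R, ‖f (u, t) ^ 2‖ₑ ≤ M := by
    rw [← lintegral_indicator Metric.isOpen_ball.measurableSet]
    refine lintegral_mono fun u => ?_
    by_cases hu : u ∈ Metric.ball z R
    · simp [g, hu, hball u hu, enorm_pow]
    · simp [hu]
  have hreal : Real.pi * R ^ 2 * ‖f (z, t)‖ ^ 2 ≤ M.toReal := by
    have := ENNReal.toReal_mono hM (hmean.trans hle)
    rwa [ENNReal.toReal_mul, ENNReal.toReal_ofReal (by positivity), toReal_enorm, norm_pow] at this
  have hnorm : ‖f (z, t)‖ ≤ √(M.toReal / (Real.pi * R ^ 2)) := by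
    refine Real.le_sqrt_of_sq_le ?_
    rw [le_div_iff₀ (by positivity)]
    linarith
  rw [wormFactor, eq_of_rotational hf.1.1 hf.2 (wormSection_mem hβ hz') hzt, norm_mul]
  simpa using mul_le_mul_of_nonneg_right hnorm (norm_nonneg (t ^ (-j)))

/-- The reproducing property of `wormKernel`. -/
theorem wormKernel_reproducing {β : ℝ} (hβ : Real.pi / 2 < β) {j : ℤ} {f : ℂ × ℂ → ℂ}
    (hf : f ∈ rotationalComponent (wormDomain β) j) {w : ℂ × ℂ} (hw : w ∈ wormDomain β) :
    f w = ∫ z in wormDomain β, f z * conj (wormKernel β j z w) := by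
  have hwim := abs_im_lt_of_mem_wormDomain hw
  have hDm := (isOpen_wormDomain β).measurableSet
  set F := wormFactor β j f
  have hF : DifferentiableOn ℂ F {z | |z.im| < β} := differentiableOn_wormFactor hβ hf.1.1 hf.2
  have hfF : ∀ z ∈ wormDomain β, f z = F z.1 * z.2 ^ j := fun z hz =>
    eq_wormFactor_mul hβ hf.1.1 hf.2 hz
  set φ : ℂ × ℂ → ℂ := fun z => f z * conj (wormKernel β j z w)
  have hφ : IntegrableOn φ (wormDomain β) :=
    hf.1.2.integrable_mul (wormKernel_mem hβ j hw).1.2.star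
  -- The regulariser: Gaussian for `ε > 0`, bounded by `e^{β²}` on the strip for `0 ≤ ε ≤ 1`, and
  -- tending to `1`.
  set e : ℝ → ℂ → ℂ := fun ε z => Complex.exp (-ε * z ^ 2)
  have he : ∀ ε : ℝ, 0 ≤ ε → ε ≤ 1 → ∀ z : ℂ, |z.im| < β → ‖e ε z‖ ≤ Real.exp (β ^ 2) := by
    intro ε hε hε1 z hz
    simp only [e]
    rw [Complex.norm_exp]
    refine Real.exp_le_exp.2 ?_
    have h2 : z.im ^ 2 ≤ β ^ 2 := sq_le_sq' (abs_lt.1 hz).1.le (abs_lt.1 hz).2.le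
    have h3 : (-(ε : ℂ) * z ^ 2).re = -ε * z.re ^ 2 + ε * z.im ^ 2 := by
      simp [sq]; ring
    rw [h3]
    nlinarith [mul_nonneg hε (sq_nonneg z.re), sq_nonneg z.im]
  have hem : ∀ ε : ℝ, AEStronglyMeasurable (fun z : ℂ × ℂ => φ z * e ε z.1)
      (volume.restrict (wormDomain β)) := fun ε =>
    hφ.aestronglyMeasurable.mul (Continuous.aestronglyMeasurable (by fun_prop))
  have heb : ∀ ε : ℝ, 0 ≤ ε → ε ≤ 1 → ∀ᵐ z ∂volume.restrict (wormDomain β),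
      ‖φ z * e ε z.1‖ ≤ ‖φ z‖ * Real.exp (β ^ 2) := by
    intro ε hε hε1
    filter_upwards [ae_restrict_mem hDm] with z hz
    rw [norm_mul]
    exact mul_le_mul_of_nonneg_left (he ε hε hε1 _ (abs_im_lt_of_mem_wormDomain hz))
      (norm_nonneg _)
  have hval : ∀ ε : ℝ, 0 < ε → ε ≤ 1 →
      ∫ z in wormDomain β, φ z * e ε z.1 = f w * e ε w.1 := by
    intro ε hε hε1
    have hint : IntegrableOn (fun z : ℂ × ℂ => φ z * e ε z.1) (wormDomain β) :=
      (hφ.norm.mul_const _).mono' (hem ε) (heb ε hε.le hε1)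
    have hdec : HasGaussianDecay β ε fun z => F z * e ε z :=
      (wormFactor_locally_bounded hβ hf).of_locally_bounded hε
    have hG : DifferentiableOn ℂ (fun z => F z * e ε z) {z | |z.im| < β} :=
      hF.mul (by fun_prop)
    rw [integral_wormDomain hint, hfF w hw, mul_right_comm,
      ← integral_wormMeasure_mul_conj_kernelFactor hβ j hε hdec hG hwim, ← integral_mul_const]
    refine integral_congr_ae ?_
    filter_upwards [ae_mem_wormFibre β] with p hp
    rw [← integral_const_mul, ← integral_mul_const]
    congr 1 with x
    have hmem : ((x : ℂ) + (p.1 : ℂ) * Complex.I, p.2) ∈ wormDomain β := by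
      rw [← wormChart_apply]; exact (wormChart_mem_iff x p).2 hp
    have hnorm : ((‖p.2 ^ j‖ ^ 2 : ℝ) : ℂ) = p.2 ^ j * conj (p.2 ^ j) := by
      rw [Complex.mul_conj']; push_cast; rfl
    simp only [φ]
    rw [hfF _ hmem, hnorm, wormKernel, map_mul, map_mul, ← map_zpow₀, Complex.conj_conj]
    ring
  have hlim : Tendsto (fun n : ℕ => ∫ z in wormDomain β, φ z * e (1 / ((n : ℝ) + 1)) z.1) atTop
      (𝓝 (∫ z in wormDomain β, φ z)) := by
    refine tendsto_integral_of_dominated_convergence (fun z => ‖φ z‖ * Real.exp (β ^ 2))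
      (fun n => hem _) (hφ.norm.mul_const _)
      (fun n => heb _ (by positivity) ((div_le_one (by positivity)).2 (by simp))) ?_
    refine Eventually.of_forall fun z => ?_
    have h := (by fun_prop : Continuous fun ε : ℝ => φ z * e ε z.1).tendsto 0
    have h2 := h.comp tendsto_one_div_add_atTop_nhds_zero_nat
    simpa [e, Function.comp_def] using h2
  have hlim' : Tendsto (fun n : ℕ => f w * e (1 / ((n : ℝ) + 1)) w.1) atTop (𝓝 (f w)) := by
    have h := (by fun_prop : Continuous fun ε : ℝ => f w * e ε w.1).tendsto 0
    have h2 := h.comp tendsto_one_div_add_atTop_nhds_zero_nat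
    simpa [e, Function.comp_def] using h2
  refine tendsto_nhds_unique hlim' (hlim.congr fun n => ?_)
  exact hval _ (by positivity) ((div_le_one (by positivity)).2 (by simp))

theorem isBergmanKernel_wormKernel {β : ℝ} (hβ : Real.pi / 2 < β) (j : ℤ) :
    IsBergmanKernel (wormDomain β) (rotationalComponent (wormDomain β) j) (wormKernel β j) :=
  ⟨fun _ hw => wormKernel_mem hβ j hw, fun _ hf _ hw => wormKernel_reproducing hβ hf hw⟩

/-- Each kernel reproduces the other, and the two integrals are conjugate. Taking `K' = K` gives
Hermitian symmetry, and the two facts together give uniqueness. -/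
theorem IsBergmanKernel.conj_eq {Ω : Set (ℂ × ℂ)} {A : Set (ℂ × ℂ → ℂ)}
    {K K' : ℂ × ℂ → ℂ × ℂ → ℂ} (hK : IsBergmanKernel Ω A K) (hK' : IsBergmanKernel Ω A K')
    {z w : ℂ × ℂ} (hz : z ∈ Ω) (hw : w ∈ Ω) : K' z w = conj (K w z) := by
  rw [hK.reproducing _ (hK'.mem w hw) z hz, hK'.reproducing _ (hK.mem z hz) w hw, ← integral_conj]
  congr 1 with u
  rw [map_mul, Complex.conj_conj, mul_comm]

theorem IsBergmanKernel.eq {Ω : Set (ℂ × ℂ)} {A : Set (ℂ × ℂ → ℂ)}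
    {K K' : ℂ × ℂ → ℂ × ℂ → ℂ} (hK : IsBergmanKernel Ω A K) (hK' : IsBergmanKernel Ω A K')
    {z w : ℂ × ℂ} (hz : z ∈ Ω) (hw : w ∈ Ω) : K' z w = K z w := by
  rw [hK.conj_eq hK' hz hw, hK.conj_eq hK hz hw]

theorem mainTheorem10 (β : ℝ) (hβ : Real.pi / 2 < β) (j : ℤ) :
    (∀ z₁ w₁ : ℂ, |z₁.im| < β → |w₁.im| < β →
      MeasureTheory.Integrable (kernelIntegrand β j z₁ w₁)) ∧
    (∀ K : ℂ × ℂ → ℂ × ℂ → ℂ,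
      IsBergmanKernel (wormDomain β) (rotationalComponent (wormDomain β) j) K ↔
        ∀ z ∈ wormDomain β, ∀ w ∈ wormDomain β,
          K z w = kernelFactor β j z.1 w.1 * z.2 ^ j * (starRingEnd ℂ w.2) ^ j) := by
  refine ⟨fun z w hz hw => integrable_kernelIntegrand hβ j
    ((abs_add_le _ _).trans_lt (by linarith)), fun K => ⟨fun hK z hz w hw =>
      (isBergmanKernel_wormKernel hβ j).eq hK hz hw, fun hK => ⟨fun w hw => ?_, fun f hf w hw => ?_⟩⟩⟩
  -- The values of `K` are prescribed only on the domain, so membership is transferred from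
  -- `wormKernel` by agreement there.
  · exact rotationalComponent_congr (wormKernel_mem hβ j hw) fun z hz => (hK z hz w hw).symm
  · rw [wormKernel_reproducing hβ hf hw]
    refine setIntegral_congr_fun (isOpen_wormDomain β).measurableSet fun z hz => ?_
    simp only [wormKernel, hK z hz w hw]

end
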